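/- Theorem. Let $\alpha,\beta,\gamma,\delta,\varepsilon,\zeta,\lambda,\mu,\nu\colon\mathbb R\to\mathbb R$ be arbitrary functions of the variable $y$, of class $C^{n+1}$ with $1\le n\le\infty$, and write $'=d/dy$. On $\mathbb R^3\ni(x,y,z)$ put $$\begin{aligned}\Pi:={}&x^2\zeta\lambda^2+\alpha\mu^2z^2+2x\alpha\mu\nu z+x^2\alpha\nu^2-\beta\lambda\mu z^2-x\beta\lambda\nu z+\delta\lambda^2z^2+x\varepsilon\lambda^2z-2x\zeta\lambda\mu-\beta\mu\nu z-x\beta\nu^2\\&+2\delta\lambda\nu z-\varepsilon\lambda\mu z+x\varepsilon\lambda\nu-x\gamma\lambda\mu z-x^2\gamma\lambda\nu+\zeta\mu^2+\delta\nu^2-\varepsilon\mu\nu+\gamma\mu^2z+x\gamma\mu\nu,\end{aligned}$$ and, on the open set $U:=\{x\lambda-\mu\neq0,\ \Pi\neq0\}\subseteq\mathbb R^3$, consider the coframe $$\tau^1:=dx+\frac{x\beta-\delta-x^2\alpha}{x\lambda-\mu}\,dy,\qquad \tau^2:=\frac{2\,\Pi}{x\lambda-\mu}\,dy,$$ $$\begin{aligned}\tau^3:={}&(-\lambda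 z-\nu)\,dx+(x\lambda-\mu)\,dz+\frac{1}{x\lambda-\mu}\big(-\varepsilon\mu+2x^2\alpha\nu+x\gamma\mu-2x\beta\nu-\beta\mu z+2\delta\lambda z\\&+2x\alpha\mu z+x\varepsilon\lambda+2\delta\nu-x^2\gamma\lambda-x\beta\lambda z\big)\,dy,\end{aligned}$$ the metric $g:=\tau^1\tau^2+\tau^2\tau^1+\tau^3\tau^3$ and the $1$-form $$\begin{aligned}A:={}&\frac{\tau^3}{2\Pi}\big(\gamma\lambda x-\gamma\mu+x\lambda\nu'+\beta\lambda z+\lambda\mu'z-2\alpha\mu z-\lambda'\mu z-\mu\nu'-x\lambda'\nu-2x\alpha\nu+\beta\nu+\mu'\nu\big)\\&+\frac{\tau^2}{2\Pi}\big(2x\alpha-\beta+x\lambda'-\mu'\big).\end{aligned}$$ (1) On $U$, $g$ is a Lorentzian metric (signature $(2,1)$) of class $C^{n+1}$, $A$ is of class $C^n$, and $(g,A)$ satisfies the Einstein–Weyl equations $R_{(\mu\nu)}-\frac13R\,g_{\mu\nu}=0$. Here $R_{\mu\nu}=R^{\rho}{}_{\mu\rho\nu}$ is the Ricci tensor of the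 Weyl connection of $(g,A)$, i.e. of the unique torsion-free connection $D$ with $Dg=2Ag$, $R_{(\mu\nu)}$ is its symmetric part, and $R=g^{\mu\nu}R_{\mu\nu}$. (2) Generically $dA\ne0$ and $[g]$ is not conformally flat; in particular $dA\not\equiv0$ and no independent component of the Cotton tensor of $[g]$ vanishes identically. Precisely, write $C_{ijk}=\nabla_kP_{ij}-\nabla_jP_{ik}$ for the Cotton tensor of $g$ in the coordinates $(x,y,z)$, where $\nabla$ is the Levi-Civita connection of $g$ and $P=\mathrm{Ric}-\frac14\mathrm{Scal}\,g$. For any nine functions $f=(\alpha,\dots,\nu)$ of class $C^3$ and any point $p\in\mathbb R^3$ there are nine smooth functions $h$ of $y$ such that, for all sufficiently small $t\ne0$, the nine functions $f+th$ give a pair $(g,A)$ with $p\in U$, with $dA\neq0$ at $p$, and with $C_{ijk}(p)\neq0$ for all $i,j,k$ with $j\ne k$. -/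

import Mathlib

open scoped Matrix ContDiff Topology

namespace EinsteinWeyl

/-! ### Local tensor calculus on open subsets of `ℝ³` -/

/-- Points of `ℝ³`; the coordinates `x, y, z` of `p` are `p 0, p 1, p 2`. -/
abbrev Pt : Type := Fin 3 → ℝ

/-- The partial derivative `∂u/∂xⁱ` at `p`. -/
noncomputable def pd (i : Fin 3) (u : Pt → ℝ) (p : Pt) : ℝ :=
  deriv (fun t : ℝ => u (Function.update p i t)) (p i)

/-- A field of bilinear forms, by its components `g_{ij}` in the basis `dx, dy, dz`. -/
abbrev Metric : Type := Pt → Matrix (Fin 3) (Fin 3) ℝ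

/-- A `1`-form, by its components `A_i` in the basis `dx, dy, dz`. -/
abbrev Form : Type := Pt → Fin 3 → ℝ

/-- Connection coefficients: `Γ p i j k = Γⁱ_{jk}(p)`, that is
`D_{∂_j} ∂_k = ∑ i, Γⁱ_{jk} ∂_i`; the connection `1`-forms are `Γⁱ_k = ∑ j, Γⁱ_{jk} dxʲ`. -/
abbrev Conn : Type := Pt → Fin 3 → Fin 3 → Fin 3 → ℝ

/-- The defining properties of the Weyl connection `D` of the pair `(g, A)` at a point:
no torsion, and `D g = 2 A g`. -/
def IsWeylConnAt (g : Metric) (A : Form) (Γ : Fin 3 → Fin 3 → Fin 3 → ℝ) (p : Pt) : Prop :=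
  (∀ i j k, Γ i j k = Γ i k j) ∧
  ∀ k i j, pd k (fun q => g q i j) p - ∑ l, Γ l k i * g p l j - ∑ l, Γ l k j * g p i l
    = 2 * A p k * g p i j

/-- The coefficients with all indices down,
`Γ_{ljk} = ½ (∂_j g_{lk} + ∂_k g_{lj} - ∂_l g_{jk}) - (A_j g_{lk} + A_k g_{lj} - A_l g_{jk})`. -/
noncomputable def weylConnLow (g : Metric) (A : Form) (p : Pt) (l j k : Fin 3) : ℝ :=
  (pd j (fun q => g q l k) p + pd k (fun q => g q l j) p - pd l (fun q => g q j k) p) / 2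
    - (A p j * g p l k + A p k * g p l j - A p l * g p j k)

/-- The Weyl connection of `(g, A)`. -/
noncomputable def weylConn (g : Metric) (A : Form) : Conn := fun p i j k =>
  ∑ l, (g p)⁻¹ i l * weylConnLow g A p l j k

lemma weylConn_lower {g : Metric} (A : Form) {p : Pt} (hd : (g p).det ≠ 0) (m j k : Fin 3) :
    ∑ i, g p m i * weylConn g A p i j k = weylConnLow g A p m j k := by
  have h : g p *ᵥ ((g p)⁻¹ *ᵥ fun l => weylConnLow g A p l j k)
      = fun l => weylConnLow g A p l j k := by
    rw [Matrix.mulVec_mulVec, Matrix.mul_nonsing_inv _ (isUnit_iff_ne_zero.mpr hd),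
      Matrix.one_mulVec]
  exact congrFun h m

/-- `weylConn g A` is the Weyl connection of `(g, A)`, wherever `g` is nondegenerate. -/
theorem isWeylConnAt_weylConn {g : Metric} (hg : ∀ q i j, g q i j = g q j i) (A : Form) {p : Pt}
    (hd : (g p).det ≠ 0) : IsWeylConnAt g A (weylConn g A p) p := by
  have hpd : ∀ k i j, pd k (fun q => g q i j) p = pd k (fun q => g q j i) p := fun k i j => by
    congr 1; funext q; exact hg q i j
  refine ⟨fun i j k => ?_, fun k i j => ?_⟩
  · refine Finset.sum_congr rfl fun l _ => ?_
    unfold weylConnLow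
    rw [hpd l j k, hg p j k]
    ring
  · have h1 : ∑ l, weylConn g A p l k i * g p l j = weylConnLow g A p j k i := by
      rw [← weylConn_lower A hd]
      exact Finset.sum_congr rfl fun l _ => by rw [hg p l j]; ring
    have h2 : ∑ l, weylConn g A p l k j * g p i l = weylConnLow g A p i k j := by
      rw [← weylConn_lower A hd]
      exact Finset.sum_congr rfl fun l _ => by ring
    rw [h1, h2]
    unfold weylConnLow
    rw [hpd k j i, hpd j k i, hpd i k j, hg p j i, hg p k i, hg p k j]
    rw [hpd j i k, hpd i j k]
    ring

/-- The Weyl connection is unique. -/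
theorem eq_weylConn {g : Metric} (hg : ∀ q i j, g q i j = g q j i) {A : Form} {p : Pt}
    (hd : (g p).det ≠ 0) {Γ : Fin 3 → Fin 3 → Fin 3 → ℝ} (h : IsWeylConnAt g A Γ p) :
    Γ = weylConn g A p := by
  obtain ⟨hs, hc⟩ := h
  have hlow : ∀ m j k, ∑ l, g p m l * Γ l j k = weylConnLow g A p m j k := by
    intro m j k
    set L : Fin 3 → Fin 3 → Fin 3 → ℝ := fun m j k => ∑ l, g p m l * Γ l j k with hL
    have e : ∀ k i j, pd k (fun q => g q i j) p = L j k i + L i k j + 2 * A p k * g p i j := by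
      intro k i j
      have := hc k i j
      have h1 : ∑ l, Γ l k i * g p l j = L j k i :=
        Finset.sum_congr rfl fun l _ => by rw [hg p l j]; ring
      have h2 : ∑ l, Γ l k j * g p i l = L i k j :=
        Finset.sum_congr rfl fun l _ => by ring
      rw [h1, h2] at this
      linarith
    have hLs : ∀ m j k, L m j k = L m k j := by
      intro m j k
      simp only [hL]
      exact Finset.sum_congr rfl fun l _ => by rw [hs l j k]
    change L m j k = _
    unfold weylConnLow
    rw [e j m k, e k m j, e m j k, hLs k j m, hLs j k m, hLs m k j]
    ring
  funext i j k
  have h : (g p)⁻¹ *ᵥ (g p *ᵥ fun l => Γ l j k) = fun l => Γ l j k := by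
    rw [Matrix.mulVec_mulVec, Matrix.nonsing_inv_mul _ (isUnit_iff_ne_zero.mpr hd),
      Matrix.one_mulVec]
  have hv : (g p *ᵥ fun l => Γ l j k) = fun l => weylConnLow g A p l j k :=
    funext fun m => hlow m j k
  rw [hv] at h
  exact (congrFun h i).symm

/-- The curvature tensor `Rⁱ_{jkl} = curv Γ p i j k l`, from
`dΓⁱ_j + ∑ m, Γⁱ_m ∧ Γᵐ_j = ½ ∑ k l, Rⁱ_{jkl} dxᵏ ∧ dxˡ`. -/
noncomputable def curv (Γ : Conn) (p : Pt) (i j k l : Fin 3) : ℝ :=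
  pd k (fun q => Γ q i l j) p - pd l (fun q => Γ q i k j) p
    + ∑ m, (Γ p i k m * Γ p m l j - Γ p i l m * Γ p m k j)

/-- The Ricci tensor `R_{ij} = ∑ k, Rᵏ_{ikj}`. -/
noncomputable def ricci (Γ : Conn) (p : Pt) (i j : Fin 3) : ℝ := ∑ k, curv Γ p k i k j

/-- The symmetric part `R_{(ij)}` of the Ricci tensor. -/
noncomputable def ricciSym (Γ : Conn) (p : Pt) (i j : Fin 3) : ℝ :=
  (ricci Γ p i j + ricci Γ p j i) / 2

/-- The scalar curvature `R = ∑ i j, gⁱʲ R_{ij}`. -/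
noncomputable def scalar (g : Metric) (Γ : Conn) (p : Pt) : ℝ :=
  ∑ i, ∑ j, (g p)⁻¹ i j * ricci Γ p i j

/-- A symmetric bilinear form on `ℝ³` of signature `(2, 1)`: in some basis (the columns of `P`)
it is `diag(1, 1, -1)`. -/
def IsLorentzian (M : Matrix (Fin 3) (Fin 3) ℝ) : Prop :=
  ∃ P : Matrix (Fin 3) (Fin 3) ℝ, IsUnit P.det ∧ Pᵀ * M * P = Matrix.diagonal ![1, 1, -1]

/-- `(g, A)` represents a Lorentzian Einstein--Weyl structure on the open set `U ⊆ ℝ³`,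
with `g` of class `Cⁿ⁺¹` and `A` of class `Cⁿ`. -/
structure IsLorentzianEinsteinWeylOn (n : ℕ∞) (U : Set Pt) (g : Metric) (A : Form) : Prop where
  isOpen : IsOpen U
  contDiffOn_metric : ∀ i j, ContDiffOn ℝ (n + 1) (fun p => g p i j) U
  contDiffOn_form : ∀ i, ContDiffOn ℝ n (fun p => A p i) U
  lorentzian : ∀ p ∈ U, IsLorentzian (g p)
  einsteinWeyl : ∀ p ∈ U, ∀ i j,
    ricciSym (weylConn g A) p i j - 1 / 3 * scalar g (weylConn g A) p * g p i j = 0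

/-- The components `(dA)_{ij} = ∂_i A_j - ∂_j A_i`. -/
noncomputable def extD (A : Form) (p : Pt) (i j : Fin 3) : ℝ :=
  pd i (fun q => A q j) p - pd j (fun q => A q i) p

/-- The Levi-Civita connection of `g`: torsion-free with `D g = 0`. -/
noncomputable def leviCivita (g : Metric) : Conn := weylConn g 0

/-- The Schouten tensor `P_{ij} = R_{ij} - ¼ R g_{ij}` of a metric in dimension `3`. -/
noncomputable def schouten (g : Metric) (p : Pt) (i j : Fin 3) : ℝ :=
  ricci (leviCivita g) p i j - scalar g (leviCivita g) p / 4 * g p i j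

/-- The covariant derivative `∇_k P_{ij}` of the Schouten tensor. -/
noncomputable def nablaSchouten (g : Metric) (p : Pt) (k i j : Fin 3) : ℝ :=
  pd k (fun q => schouten g q i j) p - ∑ l, leviCivita g p l k i * schouten g p l j
    - ∑ l, leviCivita g p l k j * schouten g p i l

/-- The Cotton tensor `C_{ijk} = ∇_k P_{ij} - ∇_j P_{ik}`; in dimension `3` it depends only on the
conformal class of `g`. -/
noncomputable def cotton (g : Metric) (p : Pt) (i j k : Fin 3) : ℝ :=
  nablaSchouten g p k i j - nablaSchouten g p j i k

/-! ### The family of pairs `(g, A)` parametrized by nine functions of `y` -/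

/-- Nine functions of the variable `y`. -/
structure Coeffs where
  (α β γ δ ε ζ lam μ ν : ℝ → ℝ)

namespace Coeffs

/-- All nine functions are of class `Cⁿ`. -/
def IsContDiff (n : WithTop ℕ∞) (f : Coeffs) : Prop :=
  ContDiff ℝ n f.α ∧ ContDiff ℝ n f.β ∧ ContDiff ℝ n f.γ ∧ ContDiff ℝ n f.δ ∧ ContDiff ℝ n f.ε ∧
  ContDiff ℝ n f.ζ ∧ ContDiff ℝ n f.lam ∧ ContDiff ℝ n f.μ ∧ ContDiff ℝ n f.ν

/-- The perturbation `f + t h` of the nine functions `f` in the direction `h`. -/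
def perturb (f h : Coeffs) (t : ℝ) : Coeffs where
  α := fun y => f.α y + t * h.α y
  β := fun y => f.β y + t * h.β y
  γ := fun y => f.γ y + t * h.γ y
  δ := fun y => f.δ y + t * h.δ y
  ε := fun y => f.ε y + t * h.ε y
  ζ := fun y => f.ζ y + t * h.ζ y
  lam := fun y => f.lam y + t * h.lam y
  μ := fun y => f.μ y + t * h.μ y
  ν := fun y => f.ν y + t * h.ν y

/-- The function `x λ - μ`. -/
def w (f : Coeffs) (p : Pt) : ℝ := p 0 * f.lam (p 1) - f.μ (p 1)

/-- The function `Π`. -/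
def bigPi (f : Coeffs) (p : Pt) : ℝ :=
  let x := p 0; let y := p 1; let z := p 2
  let α := f.α y; let β := f.β y; let γ := f.γ y
  let δ := f.δ y; let ε := f.ε y; let ζ := f.ζ y
  let l := f.lam y; let μ := f.μ y; let ν := f.ν y
  x ^ 2 * ζ * l ^ 2 + α * μ ^ 2 * z ^ 2 + 2 * x * α * μ * ν * z + x ^ 2 * α * ν ^ 2
    - β * l * μ * z ^ 2 - x * β * l * ν * z + δ * l ^ 2 * z ^ 2 + x * ε * l ^ 2 * z
    - 2 * x * ζ * l * μ - β * μ * ν * z - x * β * ν ^ 2 + 2 * δ * l * ν * z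
    - ε * l * μ * z + x * ε * l * ν - x * γ * l * μ * z - x ^ 2 * γ * l * ν
    + ζ * μ ^ 2 + δ * ν ^ 2 - ε * μ * ν + γ * μ ^ 2 * z + x * γ * μ * ν

/-- The set of points of `ℝ³` where the coframe is defined and is a basis. -/
def domain (f : Coeffs) : Set Pt := {p | f.w p ≠ 0 ∧ f.bigPi p ≠ 0}

/-- The `1`-form `τ¹`. -/
noncomputable def tau1 (f : Coeffs) : Form := fun p =>
  let x := p 0; let y := p 1
  ![1, (x * f.β y - f.δ y - x ^ 2 * f.α y) / f.w p, 0]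

/-- The `1`-form `τ²`. -/
noncomputable def tau2 (f : Coeffs) : Form := fun p => ![0, 2 * f.bigPi p / f.w p, 0]

/-- The `1`-form `τ³`. -/
noncomputable def tau3 (f : Coeffs) : Form := fun p =>
  let x := p 0; let y := p 1; let z := p 2
  let α := f.α y; let β := f.β y; let γ := f.γ y
  let δ := f.δ y; let ε := f.ε y
  let l := f.lam y; let μ := f.μ y; let ν := f.ν y
  ![-l * z - ν,
    (-ε * μ + 2 * x ^ 2 * α * ν + x * γ * μ - 2 * x * β * ν - β * μ * z + 2 * δ * l * z
      + 2 * x * α * μ * z + x * ε * l + 2 * δ * ν - x ^ 2 * γ * l - x * β * l * z) / f.w p,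
    f.w p]

/-- The metric `g = τ¹τ² + τ²τ¹ + τ³τ³`. -/
noncomputable def metric (f : Coeffs) : Metric := fun p => Matrix.of fun i j =>
  f.tau1 p i * f.tau2 p j + f.tau2 p i * f.tau1 p j + f.tau3 p i * f.tau3 p j

/-- The coefficient of `τ³ / (2 Π)` in `A`. -/
noncomputable def coeff3 (f : Coeffs) (p : Pt) : ℝ :=
  let x := p 0; let y := p 1; let z := p 2
  let α := f.α y; let β := f.β y; let γ := f.γ y
  let l := f.lam y; let μ := f.μ y; let ν := f.ν y
  let l' := deriv f.lam y; let μ' := deriv f.μ y; let ν' := deriv f.ν y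
  γ * l * x - γ * μ + x * l * ν' + β * l * z + l * μ' * z - 2 * α * μ * z
    - l' * μ * z - μ * ν' - x * l' * ν - 2 * x * α * ν + β * ν + μ' * ν

/-- The coefficient of `τ² / (2 Π)` in `A`. -/
noncomputable def coeff2 (f : Coeffs) (p : Pt) : ℝ :=
  let x := p 0; let y := p 1
  2 * x * f.α y - f.β y + x * deriv f.lam y - deriv f.μ y

/-- The `1`-form `A`. -/
noncomputable def form (f : Coeffs) : Form := fun p i =>
  f.tau3 p i * (1 / (2 * f.bigPi p)) * f.coeff3 p
    + f.tau2 p i * (1 / (2 * f.bigPi p)) * f.coeff2 p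

end Coeffs

end EinsteinWeyl

/-!
# A family of Lorentzian Einstein--Weyl structures in dimension three

Put `n = (1, x, z)`, `N = (λ, μ, -ν)` and `V = n × N`; then `V = (-b, a, -w)` with
`a = λ z + ν`, `b = μ z + x ν` and `w = x λ - μ`. The other six functions are the coefficients of a
ternary quadratic form
`q = α b² - β a b + δ a² + ε w a + ζ w² - γ w b`, depending on `y`, and `Π = q(V)`. The apparent
poles of the metric along `w = 0` cancel: expanded, it is
`g = ⟨V, dn⟩² - 2 ⟨∇q(V) × n, dn⟩ dy - 4 q*(n) dy²`, with `q*` the dual (adjugate) form of `q`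
(`Coeffs.metric_eq_polyMetric`). In the coframe `τ¹, τ², τ³` the signature is visible, and the
coframe has determinant `2 Π`.

**The Einstein--Weyl equations.** An affine change of the coordinates `x, z` acts linearly on `n`,
so it maps the family to itself, and so does multiplying the nine functions by a constant `r`, which
multiplies `g` by `r²` and fixes `A` (`Coeffs.metric_affine`, `Coeffs.form_affine`). The Weyl
connection and its Ricci tensor are natural under these changes (`weylConn_pull`, `ricci_pull`,
`EinsteinWeylAt.of_pull`), so a given point may be moved to one with `x = z = 0`, `ν = 0`, `μ = -1`.
There `g` and `A` have short Taylor expansions. `ricci_weylConn_of_jets` computes the Ricci tensor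
from them, without differentiating the inverse of `g`: the derivative of `Γ` is obtained by
differentiating the identity `g Γ = Γ_low`. The result is
`R_(ij) = -(γ + ν')² / (8 ζ²) g_ij` (`Coeffs.einsteinWeylAt_of_normalized`).

**Genericity.** Fix `f`, `h` and a point. The components of `dA` and of the Cotton tensor for
`f + t h` are rational functions of `t` whose denominators are powers of `w Π` (`IsRatFamily`), so
they are nonzero for all small `t ≠ 0` as soon as they are nonzero for one `t`. By invariance under
the scaling by `r`, they are nonzero for `f + s⁻¹ h` if and only if they are for `h + s f`, and the
latter holds for small `s ≠ 0` if it holds for `h` itself (`Coeffs.eventually_perturb`). It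
therefore suffices to have, for every point, one `h` for which `w Π`, `dA` and all components of the
Cotton tensor are nonzero there. Nine constants do: `Example.coeffs`.
-/

namespace EinsteinWeyl

/-! ### Calculus of partial derivatives -/

lemma pd_eq_fderiv {u : Pt → ℝ} {p : Pt} (h : DifferentiableAt ℝ u p) (i : Fin 3) :
    pd i u p = fderiv ℝ u p (Pi.single i 1) := by
  have h1 : HasFDerivAt u (fderiv ℝ u p) (Function.update p i (p i)) := by
    rw [Function.update_eq_self]; exact h.hasFDerivAt
  exact (h1.comp_hasDerivAt (p i) (hasDerivAt_update p i (p i))).deriv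

lemma pd_congr {u v : Pt → ℝ} {p : Pt} (h : u =ᶠ[𝓝 p] v) (i : Fin 3) : pd i u p = pd i v p := by
  have hc : Filter.Tendsto (fun t : ℝ => Function.update p i t) (𝓝 (p i)) (𝓝 p) := by
    have := (hasDerivAt_update p i (p i)).continuousAt
    rwa [ContinuousAt, Function.update_eq_self] at this
  exact Filter.EventuallyEq.deriv_eq (hc.eventually h)

@[simp] lemma pd_const (i : Fin 3) (c : ℝ) (p : Pt) : pd i (fun _ => c) p = 0 := by
  simp [pd]

lemma pd_add {u v : Pt → ℝ} {p : Pt} (hu : DifferentiableAt ℝ u p) (hv : DifferentiableAt ℝ v p)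
    (i : Fin 3) : pd i (fun q => u q + v q) p = pd i u p + pd i v p := by
  rw [pd_eq_fderiv (hu.fun_add hv), pd_eq_fderiv hu, pd_eq_fderiv hv, fderiv_fun_add hu hv]
  rfl

lemma pd_sub {u v : Pt → ℝ} {p : Pt} (hu : DifferentiableAt ℝ u p) (hv : DifferentiableAt ℝ v p)
    (i : Fin 3) : pd i (fun q => u q - v q) p = pd i u p - pd i v p := by
  rw [pd_eq_fderiv (hu.fun_sub hv), pd_eq_fderiv hu, pd_eq_fderiv hv, fderiv_fun_sub hu hv]
  rfl

lemma pd_mul {u v : Pt → ℝ} {p : Pt} (hu : DifferentiableAt ℝ u p) (hv : DifferentiableAt ℝ v p)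
    (i : Fin 3) : pd i (fun q => u q * v q) p = u p * pd i v p + pd i u p * v p := by
  rw [pd_eq_fderiv (hu.fun_mul hv), pd_eq_fderiv hu, pd_eq_fderiv hv, fderiv_fun_mul hu hv]
  simp [mul_comm]

lemma pd_const_mul (c : ℝ) (u : Pt → ℝ) (p : Pt) (i : Fin 3) :
    pd i (fun q => c * u q) p = c * pd i u p := by
  simp [pd]

lemma pd_div_const (c : ℝ) (u : Pt → ℝ) (p : Pt) (i : Fin 3) :
    pd i (fun q => u q / c) p = pd i u p / c := by
  simp [pd]

lemma pd_sum {ι : Type*} (s : Finset ι) {u : ι → Pt → ℝ} {p : Pt}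
    (hu : ∀ m ∈ s, DifferentiableAt ℝ (u m) p) (i : Fin 3) :
    pd i (fun q => ∑ m ∈ s, u m q) p = ∑ m ∈ s, pd i (u m) p := by
  rw [pd_eq_fderiv (DifferentiableAt.fun_sum hu), fderiv_fun_sum hu, sum_apply]
  exact Finset.sum_congr rfl fun m hm => (pd_eq_fderiv (hu m hm) i).symm

lemma pd_div {u v : Pt → ℝ} {p : Pt} (hu : DifferentiableAt ℝ u p) (hv : DifferentiableAt ℝ v p)
    (h0 : v p ≠ 0) (i : Fin 3) :
    pd i (fun q => u q / v q) p = (pd i u p * v p - u p * pd i v p) / v p ^ 2 := by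
  have hd : DifferentiableAt ℝ (fun q => u q / v q) p := by
    simp only [div_eq_mul_inv]
    exact hu.fun_mul (hv.fun_inv h0)
  have e : pd i u p = pd i (fun q => u q / v q * v q) p := by
    refine pd_congr ?_ i
    filter_upwards [hv.continuousAt.eventually_ne h0] with q hq
    field_simp
  rw [e, pd_mul hd hv]
  field_simp
  ring

lemma contDiffAt_pd {u : Pt → ℝ} {p : Pt} {m n : WithTop ℕ∞} (hu : ContDiffAt ℝ n u p)
    (hmn : m + 1 ≤ n) (i : Fin 3) : ContDiffAt ℝ m (fun q => pd i u q) p := by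
  have h1 : ContDiffAt ℝ m (fun q => fderiv ℝ u q (Pi.single i 1)) p :=
    (hu.fderiv_right hmn).clm_apply contDiffAt_const
  refine h1.congr_of_eventuallyEq ?_
  have h2 : ∀ᶠ q in 𝓝 p, ContDiffAt ℝ 1 u q :=
    (hu.of_le (le_trans le_add_self hmn)).eventually (by simp)
  filter_upwards [h2] with q hq
  exact pd_eq_fderiv (hq.differentiableAt (by simp)) i

lemma contDiff_pd {u : Pt → ℝ} {m n : WithTop ℕ∞} (hu : ContDiff ℝ n u)
    (hmn : m + 1 ≤ n) (i : Fin 3) : ContDiff ℝ m (fun q => pd i u q) :=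
  contDiff_iff_contDiffAt.2 fun _ => contDiffAt_pd hu.contDiffAt hmn i

/-! ### Differentiability of the Weyl connection -/

lemma contDiffAt_det {g : Metric} {p : Pt} {n : WithTop ℕ∞}
    (hg : ∀ i j, ContDiffAt ℝ n (fun q => g q i j) p) :
    ContDiffAt ℝ n (fun q => (g q).det) p := by
  simp only [Matrix.det_fin_three]
  fun_prop

lemma contDiffAt_inv {g : Metric} {p : Pt} {n : WithTop ℕ∞}
    (hg : ∀ i j, ContDiffAt ℝ n (fun q => g q i j) p) (hd : (g p).det ≠ 0) (i j : Fin 3) :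
    ContDiffAt ℝ n (fun q => (g q)⁻¹ i j) p := by
  have h1 := contDiffAt_det hg
  have h2 : ContDiffAt ℝ n (fun q => (g q).adjugate i j) p := by
    simp only [Matrix.adjugate_fin_three]
    fin_cases i <;> fin_cases j <;> simp <;> fun_prop
  simp only [Matrix.inv_def, Matrix.smul_apply, Ring.inverse_eq_inv', smul_eq_mul]
  exact (h1.inv hd).mul h2

lemma contDiffAt_weylConnLow {g : Metric} {A : Form} {p : Pt} {m n : WithTop ℕ∞}
    (hg : ∀ i j, ContDiffAt ℝ n (fun q => g q i j) p) (hmn : m + 1 ≤ n)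
    (hA : ∀ i, ContDiffAt ℝ m (fun q => A q i) p) (l j k : Fin 3) :
    ContDiffAt ℝ m (fun q => weylConnLow g A q l j k) p := by
  have h1 : ∀ a b c, ContDiffAt ℝ m (fun q => pd a (fun q => g q b c) q) p :=
    fun a b c => contDiffAt_pd (hg b c) hmn a
  have h2 : ∀ b c, ContDiffAt ℝ m (fun q => g q b c) p :=
    fun b c => (hg b c).of_le (le_trans le_self_add hmn)
  unfold weylConnLow
  fun_prop

lemma contDiffAt_weylConn {g : Metric} {A : Form} {p : Pt} {m n : WithTop ℕ∞}
    (hg : ∀ i j, ContDiffAt ℝ n (fun q => g q i j) p) (hmn : m + 1 ≤ n)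
    (hA : ∀ i, ContDiffAt ℝ m (fun q => A q i) p) (hd : (g p).det ≠ 0) (i j k : Fin 3) :
    ContDiffAt ℝ m (fun q => weylConn g A q i j k) p := by
  unfold weylConn
  exact ContDiffAt.sum fun l _ => (contDiffAt_inv (fun i j => (hg i j).of_le
    (le_trans le_self_add hmn)) hd i l).mul (contDiffAt_weylConnLow hg hmn hA l j k)

/-- The derivatives of the Weyl connection, from differentiating `g Γ = Γ_low`. -/
lemma pd_weylConn {g : Metric} {A : Form} {p : Pt}
    (hg : ∀ i j, ContDiffAt ℝ 2 (fun q => g q i j) p)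
    (hA : ∀ i, ContDiffAt ℝ 1 (fun q => A q i) p) (hd : (g p).det ≠ 0) (m i j k : Fin 3) :
    pd m (fun q => weylConn g A q i j k) p
      = ∑ l, (g p)⁻¹ i l * (pd m (fun q => weylConnLow g A q l j k) p
          - ∑ n, pd m (fun q => g q l n) p * weylConn g A p n j k) := by
  have hm : (1 : WithTop ℕ∞) + 1 ≤ 2 := by norm_num
  have hG : ∀ a b, DifferentiableAt ℝ (fun q => g q a b) p := fun a b =>
    (hg a b).differentiableAt (by simp)
  have hW : ∀ a b c, DifferentiableAt ℝ (fun q => weylConn g A q a b c) p := fun a b c =>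
    (contDiffAt_weylConn hg hm hA hd a b c).differentiableAt (by simp)
  have hdet : ∀ᶠ q in 𝓝 p, (g q).det ≠ 0 := (contDiffAt_det hg).continuousAt.eventually_ne hd
  have key : ∀ l, pd m (fun q => weylConnLow g A q l j k) p
      - ∑ n, pd m (fun q => g q l n) p * weylConn g A p n j k
      = (g p *ᵥ fun n => pd m (fun q => weylConn g A q n j k) p) l := by
    intro l
    have e : pd m (fun q => weylConnLow g A q l j k) p
        = pd m (fun q => ∑ n, g q l n * weylConn g A q n j k) p := by
      refine pd_congr ?_ m
      filter_upwards [hdet] with q hq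
      exact (weylConn_lower A hq l j k).symm
    rw [e, pd_sum _ fun n _ => (hG l n).fun_mul (hW n j k)]
    simp only [pd_mul (hG _ _) (hW _ _ _), Finset.sum_add_distrib, Matrix.mulVec, dotProduct]
    ring
  simp only [key]
  change _ = ((g p)⁻¹ *ᵥ (g p *ᵥ fun n => pd m (fun q => weylConn g A q n j k) p)) i
  rw [Matrix.mulVec_mulVec, Matrix.nonsing_inv_mul _ (isUnit_iff_ne_zero.mpr hd),
    Matrix.one_mulVec]

lemma pd_weylConnLow {g : Metric} {A : Form} {p : Pt}
    (hg : ∀ i j, ContDiffAt ℝ 2 (fun q => g q i j) p)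
    (hA : ∀ i, ContDiffAt ℝ 1 (fun q => A q i) p) (m l j k : Fin 3) :
    pd m (fun q => weylConnLow g A q l j k) p
      = (pd m (fun q => pd j (fun q => g q l k) q) p + pd m (fun q => pd k (fun q => g q l j) q) p
          - pd m (fun q => pd l (fun q => g q j k) q) p) / 2
        - (A p j * pd m (fun q => g q l k) p + pd m (fun q => A q j) p * g p l k
          + (A p k * pd m (fun q => g q l j) p + pd m (fun q => A q k) p * g p l j)
          - (A p l * pd m (fun q => g q j k) p + pd m (fun q => A q l) p * g p j k)) := by
  have hm : (1 : WithTop ℕ∞) + 1 ≤ 2 := by norm_num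
  have hG : ∀ a b, DifferentiableAt ℝ (fun q => g q a b) p := fun a b =>
    (hg a b).differentiableAt (by simp)
  have hA' : ∀ a, DifferentiableAt ℝ (fun q => A q a) p := fun a =>
    (hA a).differentiableAt (by simp)
  have hD : ∀ a b c, DifferentiableAt ℝ (fun q => pd a (fun q => g q b c) q) p := fun a b c =>
    (contDiffAt_pd (hg b c) hm a).differentiableAt (by simp)
  unfold weylConnLow
  rw [pd_sub (by fun_prop) (by fun_prop), pd_div_const, pd_sub (by fun_prop) (by fun_prop),
    pd_add (by fun_prop) (by fun_prop), pd_sub (by fun_prop) (by fun_prop),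
    pd_add (by fun_prop) (by fun_prop), pd_mul (by fun_prop) (by fun_prop),
    pd_mul (by fun_prop) (by fun_prop), pd_mul (by fun_prop) (by fun_prop)]

/-! ### Homotheties and affine changes of coordinates -/

lemma inv_smul_metric {c : ℝ} (hc : c ≠ 0) (g : Metric) (p : Pt) :
    (c • g p)⁻¹ = c⁻¹ • (g p)⁻¹ := by
  by_cases hd : IsUnit (g p).det
  · have := invertibleOfNonzero hc
    rw [Matrix.inv_smul _ _ hd]; simp
  · have : ¬ IsUnit (c • g p).det := by
      rw [Matrix.det_smul]
      simpa [isUnit_iff_ne_zero, hc] using hd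
    rw [Matrix.nonsing_inv_apply_not_isUnit _ hd, Matrix.nonsing_inv_apply_not_isUnit _ this,
      smul_zero]

lemma weylConn_smul {c : ℝ} (hc : c ≠ 0) (g : Metric) (A : Form) :
    weylConn (fun p => c • g p) A = weylConn g A := by
  funext p i j k
  have hl : ∀ l, weylConnLow (fun p => c • g p) A p l j k = c * weylConnLow g A p l j k := by
    intro l
    simp only [weylConnLow, Matrix.smul_apply, smul_eq_mul, pd_const_mul]
    ring
  simp only [weylConn, hl, inv_smul_metric hc, Matrix.smul_apply, smul_eq_mul]
  refine Finset.sum_congr rfl fun l _ => ?_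
  field_simp

/-- The affine change of coordinates `(x, y, z) ↦ (x₀ + x, y, z₀ + z + c x)`. -/
def shear (x₀ z₀ c : ℝ) (q : Pt) : Pt := ![x₀ + q 0, q 1, z₀ + q 2 + c * q 0]

/-- The Jacobian matrix of `shear x₀ z₀ c`. -/
def shearJac (c : ℝ) : Matrix (Fin 3) (Fin 3) ℝ := !![1, 0, 0; 0, 1, 0; c, 0, 1]

lemma shearJac_mul_neg (c : ℝ) : shearJac (-c) * shearJac c = 1 := by
  ext i j
  fin_cases i <;> fin_cases j <;> simp [shearJac, Matrix.mul_apply, Fin.sum_univ_three]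

lemma continuous_shear (x₀ z₀ c : ℝ) : Continuous (shear x₀ z₀ c) := by
  unfold shear
  refine continuous_pi fun i => ?_
  fin_cases i <;> simp <;> fun_prop

/-- The chain rule for `shear`. -/
lemma pd_comp_shear (x₀ z₀ c : ℝ) {u : Pt → ℝ} {q : Pt}
    (hu : DifferentiableAt ℝ u (shear x₀ z₀ c q)) (i : Fin 3) :
    pd i (fun q => u (shear x₀ z₀ c q)) q
      = ∑ j, shearJac c j i * pd j u (shear x₀ z₀ c q) := by
  have h1 : HasFDerivAt u (fderiv ℝ u (shear x₀ z₀ c q))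
      (shear x₀ z₀ c (Function.update q i (q i))) := by
    rw [Function.update_eq_self]; exact hu.hasFDerivAt
  have h2 : HasDerivAt (fun t : ℝ => shear x₀ z₀ c (Function.update q i t))
      (fun j => shearJac c j i) (q i) := by
    refine hasDerivAt_pi.2 fun j => ?_
    fin_cases i <;> fin_cases j <;> simp [shear, shearJac, hasDerivAt_const, hasDerivAt_id']
    · exact (hasDerivAt_id' (q 0)).const_add _
    · exact ((hasDerivAt_id' (q 0)).const_mul c).congr_deriv (mul_one c)
    · exact (hasDerivAt_id' (q 2)).const_add _
  have h3 : pd i (fun q => u (shear x₀ z₀ c q)) q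
      = fderiv ℝ u (shear x₀ z₀ c q) (fun j => shearJac c j i) :=
    (h1.comp_hasDerivAt (q i) h2).deriv
  have h4 : (fun j => shearJac c j i) = ∑ j, shearJac c j i • (Pi.single j 1 : Pt) := by
    funext k
    simp [Finset.sum_apply, Pi.single_apply]
  rw [h3, h4, map_sum]
  refine Finset.sum_congr rfl fun j _ => ?_
  rw [map_smul, pd_eq_fderiv hu, smul_eq_mul]

/-- The pullback of a field of bilinear forms by `shear x₀ z₀ c`. -/
def Metric.pull (x₀ z₀ c : ℝ) (g : Metric) : Metric := fun q =>
  (shearJac c)ᵀ * g (shear x₀ z₀ c q) * shearJac c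

/-- The pullback of a `1`-form by `shear x₀ z₀ c`. -/
def Form.pull (x₀ z₀ c : ℝ) (A : Form) : Form := fun q =>
  A (shear x₀ z₀ c q) ᵥ* shearJac c

/-- The components of a connection in the coordinates given by `shear x₀ z₀ c`. -/
def Conn.pull (x₀ z₀ c : ℝ) (Γ : Conn) : Conn := fun q i j k =>
  ∑ a, shearJac (-c) i a * ∑ b, ∑ d, shearJac c b j * shearJac c d k * Γ (shear x₀ z₀ c q) a b d

/-- The Weyl connection is natural under `shear x₀ z₀ c`, whose Jacobian matrix is constant. -/
lemma weylConn_pull (x₀ z₀ c : ℝ) {g : Metric} (A : Form) {q : Pt}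
    (hg : ∀ i j, DifferentiableAt ℝ (fun q => g q i j) (shear x₀ z₀ c q)) :
    weylConn (g.pull x₀ z₀ c) (A.pull x₀ z₀ c) q = (weylConn g A).pull x₀ z₀ c q := by
  have hgp : ∀ q i j, g.pull x₀ z₀ c q i j
      = ∑ a, ∑ b, shearJac c a i * shearJac c b j * g (shear x₀ z₀ c q) a b := by
    intro q i j
    simp only [Metric.pull, Matrix.mul_apply, Matrix.transpose_apply, Finset.sum_mul]
    rw [Finset.sum_comm]
    exact Finset.sum_congr rfl fun a _ => Finset.sum_congr rfl fun b _ => by ring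
  have hgpd : ∀ m i j, pd m (fun q => g.pull x₀ z₀ c q i j) q
      = ∑ a, ∑ b, shearJac c a i * shearJac c b j *
          ∑ n, shearJac c n m * pd n (fun q => g q a b) (shear x₀ z₀ c q) := by
    intro m i j
    have hs : DifferentiableAt ℝ (shear x₀ z₀ c) q := by
      unfold shear
      refine differentiableAt_pi.2 fun i => ?_
      fin_cases i <;> simp <;> fun_prop
    have hd : ∀ a b, DifferentiableAt ℝ (fun q => g (shear x₀ z₀ c q) a b) q :=
      fun a b => (hg a b).comp q hs
    simp only [hgp]
    rw [pd_sum _ fun a _ => by fun_prop]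
    refine Finset.sum_congr rfl fun a _ => ?_
    rw [pd_sum _ fun a _ => by fun_prop]
    refine Finset.sum_congr rfl fun b _ => ?_
    rw [pd_const_mul, pd_comp_shear x₀ z₀ c (hg a b)]
  have hlow : ∀ l j k, weylConnLow (g.pull x₀ z₀ c) (A.pull x₀ z₀ c) q l j k
      = ((shearJac c)ᵀ *ᵥ fun a => ∑ b, ∑ d, shearJac c b j * shearJac c d k *
          weylConnLow g A (shear x₀ z₀ c q) a b d) l := by
    intro l j k
    rw [weylConnLow, hgpd, hgpd, hgpd]
    simp only [weylConnLow, hgp, Form.pull, Matrix.mulVec, Matrix.vecMul, dotProduct,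
      Matrix.transpose_apply, Fin.sum_univ_three]
    ring
  have hinv : (g.pull x₀ z₀ c q)⁻¹
      = shearJac (-c) * (g (shear x₀ z₀ c q))⁻¹ * (shearJac (-c))ᵀ := by
    have h1 : (shearJac c)⁻¹ = shearJac (-c) := Matrix.inv_eq_left_inv (shearJac_mul_neg c)
    rw [Metric.pull, Matrix.mul_inv_rev, Matrix.mul_inv_rev, ← Matrix.transpose_nonsing_inv, h1,
      Matrix.mul_assoc]
  have hM : (shearJac (-c))ᵀ * (shearJac c)ᵀ = 1 := by
    rw [← Matrix.transpose_mul]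
    have := shearJac_mul_neg (-c)
    rw [neg_neg] at this
    rw [this, Matrix.transpose_one]
  funext i j k
  change ((g.pull x₀ z₀ c q)⁻¹ *ᵥ
    fun l => weylConnLow (g.pull x₀ z₀ c) (A.pull x₀ z₀ c) q l j k) i = _
  simp only [hlow]
  rw [hinv]
  change (_ *ᵥ ((shearJac c)ᵀ *ᵥ _)) i = _
  rw [Matrix.mulVec_mulVec, Matrix.mul_assoc, hM, Matrix.mul_one, ← Matrix.mulVec_mulVec]
  simp only [Conn.pull, weylConn, Matrix.mulVec, dotProduct]
  refine Finset.sum_congr rfl fun a _ => ?_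
  congr 1
  simp only [Finset.mul_sum]
  rw [Finset.sum_comm]
  refine Finset.sum_congr rfl fun b _ => ?_
  rw [Finset.sum_comm]
  exact Finset.sum_congr rfl fun d _ => Finset.sum_congr rfl fun e _ => by ring

/-- The Ricci tensor is natural under `shear x₀ z₀ c`. -/
lemma ricci_pull (x₀ z₀ c : ℝ) {Γ Γ' : Conn} {q : Pt}
    (hΓ : ∀ i j k, DifferentiableAt ℝ (fun q => Γ q i j k) (shear x₀ z₀ c q))
    (h : ∀ᶠ q' in 𝓝 q, Γ' q' = Γ.pull x₀ z₀ c q') (i j : Fin 3) :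
    ricci Γ' q i j
      = ∑ a, ∑ b, shearJac c a i * shearJac c b j * ricci Γ (shear x₀ z₀ c q) a b := by
  have hpd : ∀ m i j k, pd m (fun q => Γ' q i j k) q
      = ∑ a, shearJac (-c) i a * ∑ b, ∑ d, shearJac c b j * shearJac c d k *
          ∑ n, shearJac c n m * pd n (fun q => Γ q a b d) (shear x₀ z₀ c q) := by
    intro m i j k
    have hs : DifferentiableAt ℝ (shear x₀ z₀ c) q := by
      unfold shear
      refine differentiableAt_pi.2 fun i => ?_
      fin_cases i <;> simp <;> fun_prop
    have hd : ∀ a b d, DifferentiableAt ℝ (fun q => Γ (shear x₀ z₀ c q) a b d) q :=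
      fun a b d => (hΓ a b d).comp q hs
    have e : pd m (fun q => Γ' q i j k) q = pd m (fun q => Γ.pull x₀ z₀ c q i j k) q := by
      refine pd_congr ?_ m
      filter_upwards [h] with q' hq'
      rw [hq']
    rw [e]
    unfold Conn.pull
    rw [pd_sum _ fun a _ => by fun_prop]
    refine Finset.sum_congr rfl fun a _ => ?_
    rw [pd_const_mul, pd_sum _ fun b _ => by fun_prop]
    congr 1
    refine Finset.sum_congr rfl fun b _ => ?_
    rw [pd_sum _ fun b _ => by fun_prop]
    refine Finset.sum_congr rfl fun d _ => ?_
    rw [pd_const_mul, pd_comp_shear x₀ z₀ c (hΓ a b d)]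
  simp only [ricci, curv, hpd, h.self_of_nhds, Conn.pull]
  generalize Γ (shear x₀ z₀ c q) = G
  generalize (fun n a b d => pd n (fun q => Γ q a b d) (shear x₀ z₀ c q)) = D
  fin_cases i <;> fin_cases j <;> simp [Fin.sum_univ_three, shearJac] <;> ring

namespace Coeffs

/-! ### Regularity of the family -/

lemma IsContDiff.of_le {m n : WithTop ℕ∞} {f : Coeffs} (h : f.IsContDiff n) (hmn : m ≤ n) :
    f.IsContDiff m := by
  obtain ⟨h1, h2, h3, h4, h5, h6, h7, h8, h9⟩ := h
  exact ⟨h1.of_le hmn, h2.of_le hmn, h3.of_le hmn, h4.of_le hmn, h5.of_le hmn, h6.of_le hmn,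
    h7.of_le hmn, h8.of_le hmn, h9.of_le hmn⟩

lemma contDiff_comp_y {n : WithTop ℕ∞} {u : ℝ → ℝ} (h : ContDiff ℝ n u) :
    ContDiff ℝ n (fun p : Pt => u (p 1)) := h.comp (contDiff_apply ℝ ℝ 1)

lemma contDiff_deriv {n : ℕ∞} {u : ℝ → ℝ} (h : ContDiff ℝ (n + 1) u) : ContDiff ℝ n (deriv u) :=
  (contDiff_succ_iff_deriv.1 h).2.2

variable {n : WithTop ℕ∞} {f : Coeffs}

lemma contDiff_w (h : f.IsContDiff n) : ContDiff ℝ n f.w := by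
  obtain ⟨-, -, -, -, -, -, h7, h8, -⟩ := h
  have h7 := contDiff_comp_y h7
  have h8 := contDiff_comp_y h8
  unfold w
  fun_prop

lemma contDiff_bigPi (h : f.IsContDiff n) : ContDiff ℝ n f.bigPi := by
  obtain ⟨h1, h2, h3, h4, h5, h6, h7, h8, h9⟩ := h
  have h1 := contDiff_comp_y h1
  have h2 := contDiff_comp_y h2
  have h3 := contDiff_comp_y h3
  have h4 := contDiff_comp_y h4
  have h5 := contDiff_comp_y h5
  have h6 := contDiff_comp_y h6
  have h7 := contDiff_comp_y h7
  have h8 := contDiff_comp_y h8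
  have h9 := contDiff_comp_y h9
  unfold bigPi
  fun_prop

lemma isOpen_domain (h : f.IsContDiff n) : IsOpen f.domain :=
  (isOpen_ne_fun (contDiff_w h).continuous continuous_const).inter
    (isOpen_ne_fun (contDiff_bigPi h).continuous continuous_const)

lemma contDiffAt_tau1 (h : f.IsContDiff n) {p : Pt} (hp : f.w p ≠ 0) (i : Fin 3) :
    ContDiffAt ℝ n (fun q => f.tau1 q i) p := by
  have hw := (contDiff_w h).contDiffAt (x := p)
  obtain ⟨h1, h2, h3, h4, h5, h6, h7, h8, h9⟩ := h
  have h1 := contDiff_comp_y h1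
  have h2 := contDiff_comp_y h2
  have h4 := contDiff_comp_y h4
  fin_cases i
  · exact contDiffAt_const
  · exact ContDiffAt.div (by fun_prop) hw hp
  · exact contDiffAt_const

lemma contDiffAt_tau2 (h : f.IsContDiff n) {p : Pt} (hp : f.w p ≠ 0) (i : Fin 3) :
    ContDiffAt ℝ n (fun q => f.tau2 q i) p := by
  have hw := (contDiff_w h).contDiffAt (x := p)
  have hP := (contDiff_bigPi h).contDiffAt (x := p)
  fin_cases i
  · exact contDiffAt_const
  · exact ContDiffAt.div (by fun_prop) hw hp
  · exact contDiffAt_const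

lemma contDiffAt_tau3 (h : f.IsContDiff n) {p : Pt} (hp : f.w p ≠ 0) (i : Fin 3) :
    ContDiffAt ℝ n (fun q => f.tau3 q i) p := by
  have hw := (contDiff_w h).contDiffAt (x := p)
  obtain ⟨h1, h2, h3, h4, h5, h6, h7, h8, h9⟩ := h
  have h1 := contDiff_comp_y h1
  have h2 := contDiff_comp_y h2
  have h3 := contDiff_comp_y h3
  have h4 := contDiff_comp_y h4
  have h5 := contDiff_comp_y h5
  have h7 := contDiff_comp_y h7
  have h8 := contDiff_comp_y h8
  have h9 := contDiff_comp_y h9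
  fin_cases i
  · change ContDiffAt ℝ n (fun q : Pt => -f.lam (q 1) * q 2 - f.ν (q 1)) p
    fun_prop
  · exact ContDiffAt.div (by fun_prop) hw hp
  · exact hw

lemma contDiffAt_metric (h : f.IsContDiff n) {p : Pt} (hp : f.w p ≠ 0) (i j : Fin 3) :
    ContDiffAt ℝ n (fun q => f.metric q i j) p := by
  have h1 := contDiffAt_tau1 h hp
  have h2 := contDiffAt_tau2 h hp
  have h3 := contDiffAt_tau3 h hp
  simp only [metric, Matrix.of_apply]
  fun_prop

lemma contDiffAt_form {n : ℕ∞} (h : f.IsContDiff (n + 1)) {p : Pt} (hp : p ∈ f.domain)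
    (i : Fin 3) : ContDiffAt ℝ n (fun q => f.form q i) p := by
  have h' : f.IsContDiff n := h.of_le le_self_add
  have t2 := contDiffAt_tau2 h' hp.1
  have t3 := contDiffAt_tau3 h' hp.1
  have hP := (contDiff_bigPi h').contDiffAt (x := p)
  obtain ⟨h1, h2, h3, h4, h5, h6, h7, h8, h9⟩ := h'
  have h1 := contDiff_comp_y h1
  have h2 := contDiff_comp_y h2
  have h3 := contDiff_comp_y h3
  have h7 := contDiff_comp_y h7
  have h8 := contDiff_comp_y h8
  have h9 := contDiff_comp_y h9
  obtain ⟨-, -, -, -, -, -, d7, d8, d9⟩ := h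
  have d7 := contDiff_comp_y (contDiff_deriv d7)
  have d8 := contDiff_comp_y (contDiff_deriv d8)
  have d9 := contDiff_comp_y (contDiff_deriv d9)
  have hc2 : ContDiffAt ℝ n f.coeff2 p := by unfold coeff2; fun_prop
  have hc3 : ContDiffAt ℝ n f.coeff3 p := by unfold coeff3; fun_prop
  have hi : ContDiffAt ℝ n (fun q => 1 / (2 * f.bigPi q)) p :=
    contDiffAt_const.div (by fun_prop) (mul_ne_zero two_ne_zero hp.2)
  unfold form
  fun_prop

/-! ### Signature -/

lemma metric_symm (f : Coeffs) (p : Pt) (i j : Fin 3) : f.metric p i j = f.metric p j i := by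
  simp only [metric, Matrix.of_apply]
  ring

/-- The metric in the coframe `τ¹, τ², τ³`. -/
lemma metric_eq_coframe (f : Coeffs) (p : Pt) :
    f.metric p = (Matrix.of ![f.tau1 p, f.tau2 p, f.tau3 p])ᵀ * !![0, 1, 0; 1, 0, 0; 0, 0, 1]
      * Matrix.of ![f.tau1 p, f.tau2 p, f.tau3 p] := by
  ext i j
  simp [metric, Matrix.mul_apply, Fin.sum_univ_three]
  ring

lemma det_coframe (f : Coeffs) {p : Pt} (hp : f.w p ≠ 0) :
    (Matrix.of ![f.tau1 p, f.tau2 p, f.tau3 p]).det = 2 * f.bigPi p := by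
  simp [Matrix.det_fin_three, tau1, tau2, tau3]
  field_simp

lemma det_metric (f : Coeffs) {p : Pt} (hp : f.w p ≠ 0) :
    (f.metric p).det = -(2 * f.bigPi p) ^ 2 := by
  rw [metric_eq_coframe, Matrix.det_mul, Matrix.det_mul, Matrix.det_transpose, det_coframe f hp]
  simp [Matrix.det_fin_three]
  ring

lemma isLorentzian_metric (f : Coeffs) {p : Pt} (hp : p ∈ f.domain) : IsLorentzian (f.metric p) := by
  set θ : Matrix (Fin 3) (Fin 3) ℝ := Matrix.of ![f.tau1 p, f.tau2 p, f.tau3 p] with hθ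
  have hdet : θ.det ≠ 0 := by
    rw [hθ, det_coframe f hp.1]; exact mul_ne_zero two_ne_zero hp.2
  have hu : IsUnit θ.det := isUnit_iff_ne_zero.2 hdet
  -- the columns are `e₁ + ½ e₂`, `e₃`, `e₁ - ½ e₂` in the frame dual to `τ¹, τ², τ³`
  refine ⟨θ⁻¹ * !![1, 0, 1; 1 / 2, 0, -1 / 2; 0, 1, 0], ?_, ?_⟩
  · rw [Matrix.det_mul]
    refine IsUnit.mul (Matrix.isUnit_nonsing_inv_det _ hu) ?_
    simp [Matrix.det_fin_three]
    norm_num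
  · have h1 : θ * θ⁻¹ = 1 := Matrix.mul_nonsing_inv _ hu
    have h2 : (θ⁻¹)ᵀ * θᵀ = 1 := by rw [← Matrix.transpose_mul, h1, Matrix.transpose_one]
    rw [metric_eq_coframe, ← hθ, Matrix.transpose_mul]
    set Q : Matrix (Fin 3) (Fin 3) ℝ := !![1, 0, 1; 1 / 2, 0, -1 / 2; 0, 1, 0] with hQ
    have e : Qᵀ * (θ⁻¹)ᵀ * (θᵀ * !![0, 1, 0; 1, 0, 0; 0, 0, 1] * θ) * (θ⁻¹ * Q)
        = Qᵀ * ((θ⁻¹)ᵀ * θᵀ) * !![0, 1, 0; 1, 0, 0; 0, 0, 1] * (θ * θ⁻¹) * Q := by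
      simp only [Matrix.mul_assoc]
    rw [e, h1, h2, Matrix.mul_one, Matrix.mul_one, hQ]
    ext i j
    fin_cases i <;> fin_cases j <;>
      simp [Matrix.mul_apply, Fin.sum_univ_three] <;> norm_num

/-! ### Affine changes of `x` and `z` and homotheties within the family -/

/-- The nine functions for which the pair `(g, A)` is the pullback by `shear x₀ z₀ c` of the one
of `f`, up to the factor `r ^ 2` in the metric. -/
def affine (f : Coeffs) (x₀ z₀ c r : ℝ) : Coeffs where
  α := fun y => r * f.α y
  β := fun y => r * (f.β y - 2 * f.α y * x₀)
  γ := fun y => r * (f.γ y - 2 * f.α y * (c * x₀ - z₀) + f.β y * c)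
  δ := fun y => r * (f.α y * x₀ ^ 2 - f.β y * x₀ + f.δ y)
  ε := fun y => r * (2 * f.α y * x₀ * (c * x₀ - z₀) - f.β y * (2 * c * x₀ - z₀)
    + 2 * f.δ y * c + f.ε y - f.γ y * x₀)
  ζ := fun y => r * (f.α y * (c * x₀ - z₀) ^ 2 - f.β y * c * (c * x₀ - z₀) + f.δ y * c ^ 2
    + f.ε y * c + f.ζ y - f.γ y * (c * x₀ - z₀))
  lam := fun y => r * f.lam y
  μ := fun y => r * (f.μ y - x₀ * f.lam y)
  ν := fun y => r * (f.ν y + f.lam y * z₀ + c * (f.μ y - x₀ * f.lam y))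

lemma IsContDiff.affine (h : f.IsContDiff n) (x₀ z₀ c r : ℝ) :
    (f.affine x₀ z₀ c r).IsContDiff n := by
  obtain ⟨h1, h2, h3, h4, h5, h6, h7, h8, h9⟩ := h
  unfold Coeffs.affine IsContDiff
  refine ⟨?_, ?_, ?_, ?_, ?_, ?_, ?_, ?_, ?_⟩ <;> dsimp only <;> fun_prop

lemma w_affine (f : Coeffs) (x₀ z₀ c r : ℝ) (q : Pt) :
    (f.affine x₀ z₀ c r).w q = r * f.w (shear x₀ z₀ c q) := by
  simp [w, affine, shear]
  ring

lemma bigPi_affine (f : Coeffs) (x₀ z₀ c r : ℝ) (q : Pt) :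
    (f.affine x₀ z₀ c r).bigPi q = r ^ 3 * f.bigPi (shear x₀ z₀ c q) := by
  simp [bigPi, affine, shear]
  ring

lemma mem_domain_affine {f : Coeffs} {x₀ z₀ c r : ℝ} (hr : r ≠ 0) {q : Pt} :
    q ∈ (f.affine x₀ z₀ c r).domain ↔ shear x₀ z₀ c q ∈ f.domain := by
  simp [domain, w_affine, bigPi_affine, hr]

lemma tau1_affine (f : Coeffs) (x₀ z₀ c : ℝ) {r : ℝ} (hr : r ≠ 0) (q : Pt) :
    (f.affine x₀ z₀ c r).tau1 q = f.tau1 (shear x₀ z₀ c q) ᵥ* shearJac c := by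
  funext i
  fin_cases i <;> simp [tau1, w_affine, Matrix.vecMul, dotProduct, Fin.sum_univ_three, shearJac]
  rw [← mul_div_mul_left _ (f.w _) hr]
  congr 1
  simp [affine, shear]
  ring

lemma tau2_affine (f : Coeffs) (x₀ z₀ c : ℝ) {r : ℝ} (hr : r ≠ 0) (q : Pt) :
    (f.affine x₀ z₀ c r).tau2 q = r ^ 2 • (f.tau2 (shear x₀ z₀ c q) ᵥ* shearJac c) := by
  funext i
  fin_cases i <;> simp [tau2, w_affine, bigPi_affine, shearJac]
  rw [← mul_div_mul_left _ (f.w _) hr]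
  ring

lemma tau3_affine (f : Coeffs) (x₀ z₀ c : ℝ) {r : ℝ} (hr : r ≠ 0) (q : Pt) :
    (f.affine x₀ z₀ c r).tau3 q = r • (f.tau3 (shear x₀ z₀ c q) ᵥ* shearJac c) := by
  funext i
  fin_cases i <;> simp [tau3, w_affine, shearJac]
  · simp [affine, shear, w]; ring
  · rw [← mul_div_mul_left _ (f.w _) hr, ← mul_div_assoc]
    congr 1
    simp [affine, shear]
    ring

lemma metric_affine (f : Coeffs) (x₀ z₀ c : ℝ) {r : ℝ} (hr : r ≠ 0) :
    (f.affine x₀ z₀ c r).metric = fun q => r ^ 2 • f.metric.pull x₀ z₀ c q := by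
  funext q
  ext i j
  simp only [metric, Metric.pull, Matrix.of_apply, Matrix.smul_apply, tau1_affine f _ _ _ hr,
    tau2_affine f _ _ _ hr, tau3_affine f _ _ _ hr, Pi.smul_apply, smul_eq_mul, Matrix.mul_apply,
    Matrix.transpose_apply, Matrix.vecMul, dotProduct, Fin.sum_univ_three]
  ring

lemma coeff2_affine {f : Coeffs} (h : f.IsContDiff 1) (x₀ z₀ c r : ℝ) (q : Pt) :
    (f.affine x₀ z₀ c r).coeff2 q = r * f.coeff2 (shear x₀ z₀ c q) := by
  obtain ⟨-, -, -, -, -, -, h7, h8, -⟩ := h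
  have h7 := h7.differentiable (by simp)
  have h8 := h8.differentiable (by simp)
  have e7 : deriv (f.affine x₀ z₀ c r).lam (q 1) = r * deriv f.lam (q 1) :=
    ((h7 _).hasDerivAt.const_mul r).deriv
  have e8 : deriv (f.affine x₀ z₀ c r).μ (q 1) = r * (deriv f.μ (q 1) - x₀ * deriv f.lam (q 1)) :=
    (((h8 _).hasDerivAt.sub ((h7 _).hasDerivAt.const_mul x₀)).const_mul r).deriv
  rw [coeff2, e7, e8]
  simp [coeff2, affine, shear]
  ring

lemma coeff3_affine {f : Coeffs} (h : f.IsContDiff 1) (x₀ z₀ c r : ℝ) (q : Pt) :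
    (f.affine x₀ z₀ c r).coeff3 q = r ^ 2 * f.coeff3 (shear x₀ z₀ c q) := by
  obtain ⟨-, -, -, -, -, -, h7, h8, h9⟩ := h
  have h7 := h7.differentiable (by simp)
  have h8 := h8.differentiable (by simp)
  have h9 := h9.differentiable (by simp)
  have e7 : deriv (f.affine x₀ z₀ c r).lam (q 1) = r * deriv f.lam (q 1) :=
    ((h7 _).hasDerivAt.const_mul r).deriv
  have e8 : deriv (f.affine x₀ z₀ c r).μ (q 1) = r * (deriv f.μ (q 1) - x₀ * deriv f.lam (q 1)) :=
    (((h8 _).hasDerivAt.sub ((h7 _).hasDerivAt.const_mul x₀)).const_mul r).deriv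
  have e9 : deriv (f.affine x₀ z₀ c r).ν (q 1) = r * (deriv f.ν (q 1) + deriv f.lam (q 1) * z₀
      + c * (deriv f.μ (q 1) - x₀ * deriv f.lam (q 1))) :=
    ((((h9 _).hasDerivAt.add ((h7 _).hasDerivAt.mul_const z₀)).add
      (((h8 _).hasDerivAt.sub ((h7 _).hasDerivAt.const_mul x₀)).const_mul c)).const_mul r).deriv
  rw [coeff3, e7, e8, e9]
  simp [coeff3, affine, shear]
  ring

lemma form_affine {f : Coeffs} (h : f.IsContDiff 1) (x₀ z₀ c : ℝ) {r : ℝ} (hr : r ≠ 0) :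
    (f.affine x₀ z₀ c r).form = f.form.pull x₀ z₀ c := by
  funext q i
  have e : ∀ P : ℝ, 1 / (2 * (r ^ 3 * P)) = (r ^ 3)⁻¹ * (1 / (2 * P)) := fun P => by
    rw [mul_left_comm, one_div, one_div, mul_inv]
  simp only [form, Form.pull, tau2_affine f _ _ _ hr, tau3_affine f _ _ _ hr, Pi.smul_apply,
    coeff2_affine h, coeff3_affine h, bigPi_affine, e, smul_eq_mul,
    Matrix.vecMul, dotProduct, Fin.sum_univ_three]
  field_simp
  ring

end Coeffs

/-- The Einstein--Weyl equations at a point, with the factor `R / 3` left free. -/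
def EinsteinWeylAt (g : Metric) (A : Form) (p : Pt) : Prop :=
  ∃ Λ : ℝ, ∀ i j, ricciSym (weylConn g A) p i j = Λ * g p i j

/-- Taking the trace identifies the free factor as `R / 3`. -/
lemma EinsteinWeylAt.traceFree {g : Metric} {A : Form} {p : Pt} (h : EinsteinWeylAt g A p)
    (hg : ∀ i j, g p i j = g p j i) (hd : (g p).det ≠ 0) (i j : Fin 3) :
    ricciSym (weylConn g A) p i j - 1 / 3 * scalar g (weylConn g A) p * g p i j = 0 := by
  obtain ⟨Λ, hΛ⟩ := h
  have hT : (g p)ᵀ = g p := by ext i j; exact hg j i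
  have hi : ∀ i j, (g p)⁻¹ i j = (g p)⁻¹ j i := fun i j => by
    conv_lhs => rw [← hT, ← Matrix.transpose_nonsing_inv, Matrix.transpose_apply]
  have h1 : scalar g (weylConn g A) p
      = ∑ i, ∑ j, (g p)⁻¹ i j * ricciSym (weylConn g A) p i j := by
    have h2 : scalar g (weylConn g A) p
        = ∑ i, ∑ j, (g p)⁻¹ i j * ricci (weylConn g A) p j i := by
      unfold scalar
      rw [Finset.sum_comm]
      exact Finset.sum_congr rfl fun i _ => Finset.sum_congr rfl fun j _ => by rw [hi j i]
    have h3 : ∑ i, ∑ j, (g p)⁻¹ i j * ricciSym (weylConn g A) p i j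
        = (scalar g (weylConn g A) p
          + ∑ i, ∑ j, (g p)⁻¹ i j * ricci (weylConn g A) p j i) / 2 := by
      simp only [scalar, ricciSym, Fin.sum_univ_three]
      ring
    rw [h3, ← h2]
    ring
  have h4 : scalar g (weylConn g A) p = 3 * Λ := by
    have h5 : ∀ i, ∑ j, (g p)⁻¹ i j * ricciSym (weylConn g A) p i j = Λ := by
      intro i
      have h6 : ((g p)⁻¹ * g p) i i = 1 := by
        rw [Matrix.nonsing_inv_mul _ (isUnit_iff_ne_zero.mpr hd), Matrix.one_apply_eq]
      rw [Matrix.mul_apply] at h6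
      calc _ = Λ * ∑ j, (g p)⁻¹ i j * g p j i := by
            rw [Finset.mul_sum]
            refine Finset.sum_congr rfl fun j _ => ?_
            rw [hΛ, hg i j]
            ring
        _ = Λ := by rw [h6, mul_one]
    rw [h1]
    simp only [h5]
    simp
  rw [h4, hΛ]
  ring

/-- The Einstein--Weyl equations do not depend on the coordinates nor on a constant factor in
the metric. -/
lemma EinsteinWeylAt.of_pull {x₀ z₀ c r : ℝ} (hr : r ≠ 0) {g : Metric} {A : Form} {q : Pt}
    (h : EinsteinWeylAt (fun q => r • g.pull x₀ z₀ c q) (A.pull x₀ z₀ c) q)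
    (hg : ∀ᶠ p in 𝓝 (shear x₀ z₀ c q), ∀ i j, DifferentiableAt ℝ (fun q => g q i j) p)
    (hW : ∀ i j k, DifferentiableAt ℝ (fun q => weylConn g A q i j k) (shear x₀ z₀ c q)) :
    EinsteinWeylAt g A (shear x₀ z₀ c q) := by
  obtain ⟨Λ, hΛ⟩ := h
  rw [weylConn_smul hr] at hΛ
  have hev : ∀ᶠ q' in 𝓝 q, weylConn (g.pull x₀ z₀ c) (A.pull x₀ z₀ c) q'
      = (weylConn g A).pull x₀ z₀ c q' := by
    filter_upwards [(continuous_shear x₀ z₀ c).continuousAt.eventually hg] with q' hq'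
    exact weylConn_pull x₀ z₀ c A hq'
  have hR : Matrix.of (ricciSym (weylConn (g.pull x₀ z₀ c) (A.pull x₀ z₀ c)) q)
      = (shearJac c)ᵀ * Matrix.of (ricciSym (weylConn g A) (shear x₀ z₀ c q)) * shearJac c := by
    ext i j
    simp only [Matrix.of_apply, ricciSym, ricci_pull x₀ z₀ c hW hev, Matrix.mul_apply,
      Matrix.transpose_apply, Fin.sum_univ_three]
    ring
  have hE : Matrix.of (ricciSym (weylConn (g.pull x₀ z₀ c) (A.pull x₀ z₀ c)) q)
      = (Λ * r) • g.pull x₀ z₀ c q := by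
    ext i j
    simp only [Matrix.of_apply, hΛ, Matrix.smul_apply, smul_eq_mul]
    ring
  have h1 : shearJac c * shearJac (-c) = 1 := by
    simpa using shearJac_mul_neg (-c)
  have h2 : (shearJac (-c))ᵀ * (shearJac c)ᵀ = 1 := by
    rw [← Matrix.transpose_mul, h1, Matrix.transpose_one]
  have h3 : ∀ X : Matrix (Fin 3) (Fin 3) ℝ,
      (shearJac (-c))ᵀ * ((shearJac c)ᵀ * X * shearJac c) * shearJac (-c) = X := fun X => by
    rw [← Matrix.mul_assoc, ← Matrix.mul_assoc, h2, Matrix.one_mul, Matrix.mul_assoc, h1,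
      Matrix.mul_one]
  have h4 := congrArg (fun X => (shearJac (-c))ᵀ * X * shearJac (-c)) (hR.symm.trans hE)
  simp only [Metric.pull, Matrix.mul_smul, Matrix.smul_mul, h3] at h4
  exact ⟨Λ * r, fun i j => congrFun (congrFun h4 i) j⟩

/-! ### Calculus of jets -/

/-- The value and the first partial derivatives of a function at a point. -/
@[ext] structure Jet1 where
  v : ℝ
  d : Fin 3 → ℝ

/-- The value and the first and second partial derivatives of a function at a point. -/
@[ext] structure Jet2 where
  v : ℝ
  d : Fin 3 → ℝ
  h : Fin 3 → Fin 3 → ℝ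

namespace Jet1

instance : Add Jet1 := ⟨fun a b => ⟨a.v + b.v, fun i => a.d i + b.d i⟩⟩
instance : Neg Jet1 := ⟨fun a => ⟨-a.v, fun i => -a.d i⟩⟩
instance : Sub Jet1 := ⟨fun a b => ⟨a.v - b.v, fun i => a.d i - b.d i⟩⟩
instance : Mul Jet1 := ⟨fun a b => ⟨a.v * b.v, fun i => a.v * b.d i + a.d i * b.v⟩⟩
noncomputable instance : Div Jet1 :=
  ⟨fun a b => ⟨a.v / b.v, fun i => (a.d i * b.v - a.v * b.d i) / b.v ^ 2⟩⟩

/-- The jet of a constant. -/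
def const (c : ℝ) : Jet1 := ⟨c, fun _ => 0⟩

@[simp] lemma add_v (a b : Jet1) : (a + b).v = a.v + b.v := rfl
@[simp] lemma add_d (a b : Jet1) (i : Fin 3) : (a + b).d i = a.d i + b.d i := rfl
@[simp] lemma neg_v (a : Jet1) : (-a).v = -a.v := rfl
@[simp] lemma neg_d (a : Jet1) (i : Fin 3) : (-a).d i = -a.d i := rfl
@[simp] lemma sub_v (a b : Jet1) : (a - b).v = a.v - b.v := rfl
@[simp] lemma sub_d (a b : Jet1) (i : Fin 3) : (a - b).d i = a.d i - b.d i := rfl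
@[simp] lemma mul_v (a b : Jet1) : (a * b).v = a.v * b.v := rfl
@[simp] lemma mul_d (a b : Jet1) (i : Fin 3) : (a * b).d i = a.v * b.d i + a.d i * b.v := rfl
@[simp] lemma div_v (a b : Jet1) : (a / b).v = a.v / b.v := rfl
@[simp] lemma div_d (a b : Jet1) (i : Fin 3) :
    (a / b).d i = (a.d i * b.v - a.v * b.d i) / b.v ^ 2 := rfl
@[simp] lemma const_v (c : ℝ) : (const c).v = c := rfl
@[simp] lemma const_d (c : ℝ) (i : Fin 3) : (const c).d i = 0 := rfl

end Jet1

namespace Jet2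

instance : Add Jet2 := ⟨fun a b => ⟨a.v + b.v, fun i => a.d i + b.d i,
  fun i j => a.h i j + b.h i j⟩⟩
instance : Neg Jet2 := ⟨fun a => ⟨-a.v, fun i => -a.d i, fun i j => -a.h i j⟩⟩
instance : Sub Jet2 := ⟨fun a b => ⟨a.v - b.v, fun i => a.d i - b.d i,
  fun i j => a.h i j - b.h i j⟩⟩
instance : Mul Jet2 := ⟨fun a b => ⟨a.v * b.v, fun i => a.v * b.d i + a.d i * b.v, fun i j =>
  a.v * b.h i j + a.d i * b.d j + (a.d j * b.d i + a.h i j * b.v)⟩⟩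

/-- The jet of a constant. -/
def const (c : ℝ) : Jet2 := ⟨c, fun _ => 0, fun _ _ => 0⟩

/-- The jet at `p` of the coordinate function `q ↦ q k`. -/
def coord (p : Pt) (k : Fin 3) : Jet2 := ⟨p k, fun i => if i = k then 1 else 0, fun _ _ => 0⟩

/-- The jet of a function of `y` with derivatives `v, v₁, v₂`. -/
def ofY (v v₁ v₂ : ℝ) : Jet2 := ⟨v, ![0, v₁, 0], ![![0, 0, 0], ![0, v₂, 0], ![0, 0, 0]]⟩

/-- Forget the second derivatives. -/
def toJet1 (a : Jet2) : Jet1 := ⟨a.v, a.d⟩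

@[simp] lemma add_v (a b : Jet2) : (a + b).v = a.v + b.v := rfl
@[simp] lemma add_d (a b : Jet2) (i : Fin 3) : (a + b).d i = a.d i + b.d i := rfl
@[simp] lemma add_h (a b : Jet2) (i j : Fin 3) : (a + b).h i j = a.h i j + b.h i j := rfl
@[simp] lemma neg_v (a : Jet2) : (-a).v = -a.v := rfl
@[simp] lemma neg_d (a : Jet2) (i : Fin 3) : (-a).d i = -a.d i := rfl
@[simp] lemma neg_h (a : Jet2) (i j : Fin 3) : (-a).h i j = -a.h i j := rfl
@[simp] lemma sub_v (a b : Jet2) : (a - b).v = a.v - b.v := rfl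
@[simp] lemma sub_d (a b : Jet2) (i : Fin 3) : (a - b).d i = a.d i - b.d i := rfl
@[simp] lemma sub_h (a b : Jet2) (i j : Fin 3) : (a - b).h i j = a.h i j - b.h i j := rfl
@[simp] lemma mul_v (a b : Jet2) : (a * b).v = a.v * b.v := rfl
@[simp] lemma mul_d (a b : Jet2) (i : Fin 3) : (a * b).d i = a.v * b.d i + a.d i * b.v := rfl
@[simp] lemma mul_h (a b : Jet2) (i j : Fin 3) :
    (a * b).h i j = a.v * b.h i j + a.d i * b.d j + (a.d j * b.d i + a.h i j * b.v) := rfl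
@[simp] lemma const_v (c : ℝ) : (const c).v = c := rfl
@[simp] lemma const_d (c : ℝ) (i : Fin 3) : (const c).d i = 0 := rfl
@[simp] lemma const_h (c : ℝ) (i j : Fin 3) : (const c).h i j = 0 := rfl
@[simp] lemma toJet1_v (a : Jet2) : a.toJet1.v = a.v := rfl
@[simp] lemma toJet1_d (a : Jet2) (i : Fin 3) : a.toJet1.d i = a.d i := rfl

end Jet2

/-- `a` is the 1-jet of `u` at `p`. -/
structure HasJet1 (u : Pt → ℝ) (p : Pt) (a : Jet1) : Prop where
  diff : DifferentiableAt ℝ u p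
  val : u p = a.v
  pd_eq : ∀ i, pd i u p = a.d i

/-- `a` is the 2-jet of `u` at `p`. -/
structure HasJet2 (u : Pt → ℝ) (p : Pt) (a : Jet2) : Prop where
  contDiff : ContDiffAt ℝ 2 u p
  val : u p = a.v
  pd_eq : ∀ i, pd i u p = a.d i
  pd_pd_eq : ∀ i j, pd i (fun q => pd j u q) p = a.h i j

section

variable {u v : Pt → ℝ} {p : Pt}

namespace HasJet1

variable {a b : Jet1}

lemma const (c : ℝ) (p : Pt) : HasJet1 (fun _ => c) p (.const c) :=
  ⟨by fun_prop, rfl, fun i => by simp⟩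

lemma add (hu : HasJet1 u p a) (hv : HasJet1 v p b) : HasJet1 (fun q => u q + v q) p (a + b) :=
  ⟨hu.diff.add hv.diff, by simp [hu.val, hv.val], fun i => by
    rw [pd_add hu.diff hv.diff, hu.pd_eq, hv.pd_eq]; rfl⟩

lemma sub (hu : HasJet1 u p a) (hv : HasJet1 v p b) : HasJet1 (fun q => u q - v q) p (a - b) :=
  ⟨hu.diff.sub hv.diff, by simp [hu.val, hv.val], fun i => by
    rw [pd_sub hu.diff hv.diff, hu.pd_eq, hv.pd_eq]; rfl⟩

lemma neg (hu : HasJet1 u p a) : HasJet1 (fun q => -u q) p (-a) :=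
  ⟨hu.diff.neg, by simp [hu.val], fun i => by simp [← hu.pd_eq, pd]⟩

lemma mul (hu : HasJet1 u p a) (hv : HasJet1 v p b) : HasJet1 (fun q => u q * v q) p (a * b) :=
  ⟨hu.diff.mul hv.diff, by simp [hu.val, hv.val], fun i => by
    rw [pd_mul hu.diff hv.diff, hu.pd_eq, hv.pd_eq, hu.val, hv.val]; rfl⟩

lemma div (hu : HasJet1 u p a) (hv : HasJet1 v p b) (h0 : b.v ≠ 0) :
    HasJet1 (fun q => u q / v q) p (a / b) := by
  have h0' : v p ≠ 0 := by rwa [hv.val]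
  refine ⟨?_, by simp [hu.val, hv.val], fun i => ?_⟩
  · simp only [div_eq_mul_inv]
    exact hu.diff.fun_mul (hv.diff.fun_inv h0')
  · rw [pd_div hu.diff hv.diff h0', hu.pd_eq, hv.pd_eq, hu.val, hv.val]; rfl

lemma ofY {s : ℝ → ℝ} (hs : DifferentiableAt ℝ s (p 1)) :
    HasJet1 (fun q => s (q 1)) p ⟨s (p 1), ![0, deriv s (p 1), 0]⟩ :=
  ⟨DifferentiableAt.comp (g := s) p hs (by fun_prop), rfl, fun i => by
    fin_cases i <;> simp [pd]⟩

lemma congr (hu : HasJet1 u p a) (h : v =ᶠ[𝓝 p] u) : HasJet1 v p a :=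
  ⟨hu.diff.congr_of_eventuallyEq h, h.self_of_nhds.trans hu.val, fun i =>
    (pd_congr h i).trans (hu.pd_eq i)⟩

lemma of_eq (hu : HasJet1 u p a) (hv : a.v = b.v) (hd : ∀ i, a.d i = b.d i) : HasJet1 u p b :=
  ⟨hu.diff, hu.val.trans hv, fun i => (hu.pd_eq i).trans (hd i)⟩

end HasJet1

namespace HasJet2

variable {a b : Jet2}

lemma diff (hu : HasJet2 u p a) : DifferentiableAt ℝ u p := hu.contDiff.differentiableAt (by simp)

lemma diff_pd (hu : HasJet2 u p a) (i : Fin 3) : DifferentiableAt ℝ (fun q => pd i u q) p :=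
  (contDiffAt_pd (m := 1) hu.contDiff (by norm_num) i).differentiableAt (by simp)

lemma eventually_diff (hu : HasJet2 u p a) : ∀ᶠ q in 𝓝 p, DifferentiableAt ℝ u q :=
  (hu.contDiff.eventually (by simp)).mono fun _ h => h.differentiableAt (by simp)

lemma toJet1 (hu : HasJet2 u p a) : HasJet1 u p a.toJet1 := ⟨hu.diff, hu.val, hu.pd_eq⟩

lemma const (c : ℝ) (p : Pt) : HasJet2 (fun _ => c) p (.const c) :=
  ⟨contDiffAt_const, rfl, fun i => by simp, fun i j => by simp⟩

lemma add (hu : HasJet2 u p a) (hv : HasJet2 v p b) : HasJet2 (fun q => u q + v q) p (a + b) := by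
  refine ⟨hu.contDiff.add hv.contDiff, by simp [hu.val, hv.val], fun i => ?_, fun i j => ?_⟩
  · rw [pd_add hu.diff hv.diff, hu.pd_eq, hv.pd_eq]; rfl
  · have e : (fun q => pd j (fun q => u q + v q) q) =ᶠ[𝓝 p] fun q => pd j u q + pd j v q := by
      filter_upwards [hu.eventually_diff, hv.eventually_diff] with q h1 h2
      exact pd_add h1 h2 j
    rw [pd_congr e, pd_add (hu.diff_pd j) (hv.diff_pd j), hu.pd_pd_eq, hv.pd_pd_eq]; rfl

lemma neg (hu : HasJet2 u p a) : HasJet2 (fun q => -u q) p (-a) :=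
  ⟨hu.contDiff.neg, by simp [hu.val], fun i => by simp [← hu.pd_eq, pd], fun i j => by
    simp [← hu.pd_pd_eq, pd]⟩

lemma sub (hu : HasJet2 u p a) (hv : HasJet2 v p b) : HasJet2 (fun q => u q - v q) p (a - b) := by
  have h := hu.add hv.neg
  have e : a + -b = a - b := by
    ext <;> simp [sub_eq_add_neg]
  rw [e] at h
  simpa only [sub_eq_add_neg] using h

lemma mul (hu : HasJet2 u p a) (hv : HasJet2 v p b) : HasJet2 (fun q => u q * v q) p (a * b) := by
  refine ⟨hu.contDiff.mul hv.contDiff, by simp [hu.val, hv.val], fun i => ?_, fun i j => ?_⟩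
  · rw [pd_mul hu.diff hv.diff, hu.pd_eq, hv.pd_eq, hu.val, hv.val]; rfl
  · have e : (fun q => pd j (fun q => u q * v q) q)
        =ᶠ[𝓝 p] fun q => u q * pd j v q + pd j u q * v q := by
      filter_upwards [hu.eventually_diff, hv.eventually_diff] with q h1 h2
      exact pd_mul h1 h2 j
    rw [pd_congr e, pd_add (hu.diff.fun_mul (hv.diff_pd j)) ((hu.diff_pd j).fun_mul hv.diff),
      pd_mul hu.diff (hv.diff_pd j), pd_mul (hu.diff_pd j) hv.diff, hu.pd_pd_eq, hv.pd_pd_eq,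
      hu.pd_eq, hv.pd_eq, hu.pd_eq, hv.pd_eq, hu.val, hv.val]
    rfl

lemma coord (p : Pt) (k : Fin 3) : HasJet2 (fun q => q k) p (.coord p k) := by
  have e : ∀ (i : Fin 3) (q : Pt), pd i (fun q => q k) q = if i = k then 1 else 0 := by
    intro i q
    by_cases h : i = k
    · subst h; simp [pd]
    · simp [pd, h, Function.update_of_ne (Ne.symm h)]
  exact ⟨by fun_prop, rfl, fun i => e i p, fun i j => by simp only [e, pd_const]; rfl⟩

lemma ofY {s : ℝ → ℝ} (hs : ContDiff ℝ 2 s) (p : Pt) :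
    HasJet2 (fun q => s (q 1)) p (.ofY (s (p 1)) (deriv s (p 1)) (deriv (deriv s) (p 1))) := by
  have e : ∀ (s : ℝ → ℝ) (i : Fin 3) (q : Pt),
      pd i (fun q => s (q 1)) q = ![0, deriv s (q 1), 0] i := by
    intro s i q
    fin_cases i <;> simp [pd]
  refine ⟨(hs.comp (contDiff_apply ℝ ℝ 1)).contDiffAt, rfl, fun i => e s i p, fun i j => ?_⟩
  simp only [e s]
  fin_cases j
  · fin_cases i <;> simp [Jet2.ofY]
  · refine (e (deriv s) i p).trans ?_
    fin_cases i <;> simp [Jet2.ofY]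
  · fin_cases i <;> simp [Jet2.ofY]

lemma congr (hu : HasJet2 u p a) (h : v =ᶠ[𝓝 p] u) : HasJet2 v p a :=
  ⟨hu.contDiff.congr_of_eventuallyEq h, h.self_of_nhds.trans hu.val, fun i =>
    (pd_congr h i).trans (hu.pd_eq i), fun i j => (pd_congr (h.eventually_nhds.mono
      fun _ hq => pd_congr hq j) i).trans (hu.pd_pd_eq i j)⟩

lemma of_eq (hu : HasJet2 u p a) (hv : a.v = b.v) (hd : ∀ i, a.d i = b.d i)
    (hh : ∀ i j, a.h i j = b.h i j) : HasJet2 u p b :=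
  ⟨hu.contDiff, hu.val.trans hv, fun i => (hu.pd_eq i).trans (hd i), fun i j =>
    (hu.pd_pd_eq i j).trans (hh i j)⟩

end HasJet2

end

/-! ### The Ricci tensor of a Weyl connection in terms of jets -/

/-- The Ricci tensor of the Weyl connection at a point, from the derivatives of `g` up to order
two and of `A` up to order one, the inverse `gi` of `g` and the connection `Γ` at that point. -/
lemma ricci_weylConn_of_jets {g : Metric} {A : Form} {p : Pt} (hs : ∀ q i j, g q i j = g q j i)
    {G : Fin 3 → Fin 3 → Jet2} {B : Fin 3 → Jet1} {gi : Matrix (Fin 3) (Fin 3) ℝ}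
    {Γ : Fin 3 → Fin 3 → Fin 3 → ℝ}
    (hG : ∀ i j, HasJet2 (fun q => g q i j) p (G i j)) (hB : ∀ i, HasJet1 (fun q => A q i) p (B i))
    (hA : ∀ i, ContDiffAt ℝ 1 (fun q => A q i) p)
    (hgi : gi * Matrix.of (fun i j => (G i j).v) = 1)
    (hΓs : ∀ i j k, Γ i j k = Γ i k j)
    (hΓ : ∀ k i j, (G i j).d k - ∑ l, Γ l k i * (G l j).v - ∑ l, Γ l k j * (G i l).v
      = 2 * (B k).v * (G i j).v) (i j : Fin 3) :
    ricci (weylConn g A) p i j =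
      let dlow : Fin 3 → Fin 3 → Fin 3 → Fin 3 → ℝ := fun m l j k =>
        ((G l k).h m j + (G l j).h m k - (G j k).h m l) / 2
        - ((B j).v * (G l k).d m + (B j).d m * (G l k).v
          + ((B k).v * (G l j).d m + (B k).d m * (G l j).v)
          - ((B l).v * (G j k).d m + (B l).d m * (G j k).v))
      let dΓ : Fin 3 → Fin 3 → Fin 3 → Fin 3 → ℝ := fun m i j k =>
        ∑ l, gi i l * (dlow m l j k - ∑ n, (G l n).d m * Γ n j k)
      ∑ k, (dΓ k k j i - dΓ j k k i + ∑ m, (Γ k k m * Γ m j i - Γ k j m * Γ m k i)) := by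
  have hgp : Matrix.of (fun i j => (G i j).v) = g p := by
    ext i j; exact (hG i j).val.symm
  rw [hgp] at hgi
  have hd : (g p).det ≠ 0 := fun h => by
    have := congrArg Matrix.det hgi
    simp [h] at this
  have hinv : (g p)⁻¹ = gi := Matrix.inv_eq_left_inv hgi
  have hW : weylConn g A p = Γ := by
    refine (eq_weylConn hs hd ⟨hΓs, fun k i j => ?_⟩).symm
    rw [(hG i j).pd_eq, (hB k).val, (hG i j).val, ← hΓ]
    simp only [(hG _ _).val]
  have hc : ∀ i j, ContDiffAt ℝ 2 (fun q => g q i j) p := fun i j => (hG i j).contDiff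
  simp only [ricci, curv, pd_weylConn hc hA hd, pd_weylConnLow hc hA, hinv, hW,
    (hG _ _).pd_eq, (hG _ _).pd_pd_eq, (hB _).pd_eq, (hG _ _).val, (hB _).val]

namespace Coeffs

/-! ### The polynomial form of the metric -/

/-- The function `λ z + ν`. -/
def a (f : Coeffs) (p : Pt) : ℝ := f.lam (p 1) * p 2 + f.ν (p 1)

/-- The function `μ z + x ν`. -/
def b (f : Coeffs) (p : Pt) : ℝ := f.μ (p 1) * p 2 + p 0 * f.ν (p 1)

/-- The derivative in the direction `b` of the quadratic form
`q = α b² - β a b + δ a² + ε w a + ζ w² - γ w b`. -/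
def qb (f : Coeffs) (p : Pt) : ℝ :=
  2 * f.α (p 1) * f.b p - f.β (p 1) * f.a p - f.γ (p 1) * f.w p

/-- The derivative of `q` in the direction `a`. -/
def qa (f : Coeffs) (p : Pt) : ℝ :=
  2 * f.δ (p 1) * f.a p - f.β (p 1) * f.b p + f.ε (p 1) * f.w p

/-- The derivative of `q` in the direction `w`. -/
def qw (f : Coeffs) (p : Pt) : ℝ :=
  f.ε (p 1) * f.a p + 2 * f.ζ (p 1) * f.w p - f.γ (p 1) * f.b p

/-- The dual quadratic form of `q` at `(1, -x, z)`, times `-4`. -/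
def dualq (f : Coeffs) (p : Pt) : ℝ :=
  f.ε (p 1) * f.ε (p 1) - 4 * f.δ (p 1) * f.ζ (p 1)
    + (4 * f.β (p 1) * f.ζ (p 1) - 2 * f.γ (p 1) * f.ε (p 1)) * p 0
    + (2 * f.β (p 1) * f.ε (p 1) - 4 * f.γ (p 1) * f.δ (p 1)) * p 2
    + (f.γ (p 1) * f.γ (p 1) - 4 * f.α (p 1) * f.ζ (p 1)) * (p 0 * p 0)
    + (2 * f.β (p 1) * f.γ (p 1) - 4 * f.α (p 1) * f.ε (p 1)) * (p 0 * p 2)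
    + (f.β (p 1) * f.β (p 1) - 4 * f.α (p 1) * f.δ (p 1)) * (p 2 * p 2)

/-- The metric in polynomial form,
`(a dx - w dz)² + 2 (q_w - z q_b) dx dy + 2 (x q_b + q_a) dy dz + dualq dy²`. -/
def polyMetric (f : Coeffs) : Metric := fun p =>
  !![f.a p * f.a p, f.qw p - p 2 * f.qb p, -(f.a p * f.w p);
    f.qw p - p 2 * f.qb p, f.dualq p, p 0 * f.qb p + f.qa p;
    -(f.a p * f.w p), p 0 * f.qb p + f.qa p, f.w p * f.w p]

lemma metric_eq_polyMetric (f : Coeffs) {p : Pt} (hp : f.w p ≠ 0) : f.metric p = f.polyMetric p := by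
  have hp' : p 0 * f.lam (p 1) - f.μ (p 1) ≠ 0 := hp
  ext i j
  fin_cases i <;> fin_cases j <;> simp [metric, polyMetric, tau1, tau2, tau3]
  · unfold a; ring
  · field_simp; simp [a, b, w, qb, qw, bigPi]; ring
  · unfold a; ring
  · field_simp; simp [a, b, w, qb, qw, bigPi]; ring
  · field_simp; simp [w, dualq, bigPi]; ring
  · field_simp; simp [a, b, w, qa, qb]; ring
  · unfold a; ring
  · field_simp; simp [a, b, w, qa, qb]; ring

lemma bigPi_eq (f : Coeffs) (p : Pt) : f.bigPi p = f.α (p 1) * (f.b p * f.b p)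
    - f.β (p 1) * (f.a p * f.b p) + f.δ (p 1) * (f.a p * f.a p) + f.ε (p 1) * (f.w p * f.a p)
    + f.ζ (p 1) * (f.w p * f.w p) - f.γ (p 1) * (f.w p * f.b p) := by
  simp [bigPi, a, b, w]; ring

lemma coeff3_eq (f : Coeffs) (p : Pt) : f.coeff3 p = -f.qb p + f.w p * deriv f.ν (p 1)
    + deriv f.μ (p 1) * f.a p - deriv f.lam (p 1) * f.b p := by
  simp [coeff3, a, b, w, qb]; ring

/-- The form `A` in terms of the polynomial expressions above. -/
lemma form_eq (f : Coeffs) {p : Pt} (hp : p ∈ f.domain) : f.form p =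
    ![-(f.a p * (f.coeff3 p / (2 * f.bigPi p))),
      ((p 0 * f.qb p + f.qa p) * (f.coeff3 p / (2 * f.bigPi p)) + f.coeff2 p) / f.w p,
      f.w p * (f.coeff3 p / (2 * f.bigPi p))] := by
  have h1 : f.w p ≠ 0 := hp.1
  have h2 : f.bigPi p ≠ 0 := hp.2
  have e : f.tau3 p 1 = (p 0 * f.qb p + f.qa p) / f.w p := by
    simp only [tau3, Matrix.cons_val]
    congr 1
    simp [a, b, w, qa, qb]; ring
  funext i
  fin_cases i
  · simp [form, tau2, tau3, a]; ring
  · simp only [form, Fin.mk_one, e]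
    simp [tau2]
    field_simp
  · simp [form, tau2, tau3]; ring

/-! ### The Einstein--Weyl equations at a normalized point -/

-- The `simp` calls below share one list of facts, of which each uses a part.
set_option linter.unusedSimpArgs false in
set_option linter.unusedTactic false in
set_option linter.unreachableTactic false in
set_option linter.unnecessarySeqFocus false in
set_option maxHeartbeats 4000000 in
/-- The Einstein--Weyl equations at a point with `x = z = 0`, `ν = 0` and `μ = -1`, hence
`V = (0, 0, -1)`. There `Π = ζ`, and the symmetrized Ricci tensor is
`-(γ + ν')² / (8 ζ²)` times the metric. -/
theorem einsteinWeylAt_of_normalized {f : Coeffs} (h : f.IsContDiff 2) {p : Pt} (hx : p 0 = 0)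
    (hz : p 2 = 0) (hν : f.ν (p 1) = 0) (hμ : f.μ (p 1) = -1) (hp : p ∈ f.domain) :
    EinsteinWeylAt f.metric f.form p := by
  have hdom : ∀ᶠ q in 𝓝 p, q ∈ f.domain := (isOpen_domain h).mem_nhds hp
  have hAc : ∀ i, ContDiffAt ℝ 1 (fun q => f.form q i) p := fun i =>
    contDiffAt_form (n := 1) (h.of_le (by norm_num)) hp i
  have hζ : f.ζ (p 1) ≠ 0 := by
    have := hp.2
    simpa [bigPi, hx, hz, hν, hμ] using this
  obtain ⟨h1, h2, h3, h4, h5, h6, h7, h8, h9⟩ := h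
  have d7 := (contDiff_deriv (n := 1) h7).differentiable (by simp)
  have d8 := (contDiff_deriv (n := 1) h8).differentiable (by simp)
  have d9 := (contDiff_deriv (n := 1) h9).differentiable (by simp)
  have jα := HasJet2.ofY h1 p
  have jβ := HasJet2.ofY h2 p
  have jγ := HasJet2.ofY h3 p
  have jδ := HasJet2.ofY h4 p
  have jε := HasJet2.ofY h5 p
  have jζ := HasJet2.ofY h6 p
  have jl := HasJet2.ofY h7 p
  have jμ := HasJet2.ofY h8 p
  have jν := HasJet2.ofY h9 p
  have el := HasJet1.ofY (d7 (p 1))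
  have eμ := HasJet1.ofY (d8 (p 1))
  have eν := HasJet1.ofY (d9 (p 1))
  have jx := HasJet2.coord p 0
  have jz := HasJet2.coord p 2
  rw [hμ] at jμ
  rw [hν] at jν
  -- From here on the values and the derivatives of the nine functions at `y` are free parameters.
  generalize f.α (p 1) = α at *
  generalize deriv (deriv f.α) (p 1) = α₂ at jα
  generalize deriv f.α (p 1) = α₁ at jα
  generalize f.β (p 1) = β at *
  generalize deriv (deriv f.β) (p 1) = β₂ at jβ
  generalize deriv f.β (p 1) = β₁ at jβ
  generalize f.γ (p 1) = γ at *
  generalize deriv (deriv f.γ) (p 1) = γ₂ at jγ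
  generalize deriv f.γ (p 1) = γ₁ at jγ
  generalize f.δ (p 1) = δ at *
  generalize deriv (deriv f.δ) (p 1) = δ₂ at jδ
  generalize deriv f.δ (p 1) = δ₁ at jδ
  generalize f.ε (p 1) = ε at *
  generalize deriv (deriv f.ε) (p 1) = ε₂ at jε
  generalize deriv f.ε (p 1) = ε₁ at jε
  generalize f.ζ (p 1) = ζ at *
  generalize deriv (deriv f.ζ) (p 1) = ζ₂ at jζ
  generalize deriv f.ζ (p 1) = ζ₁ at jζ
  generalize f.lam (p 1) = l at *
  generalize deriv (deriv f.lam) (p 1) = l₂ at jl el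
  generalize deriv f.lam (p 1) = l₁ at jl el
  generalize deriv (deriv f.μ) (p 1) = μ₂ at jμ eμ
  generalize deriv f.μ (p 1) = μ₁ at jμ eμ
  generalize deriv (deriv f.ν) (p 1) = ν₂ at jν eν
  generalize deriv f.ν (p 1) = ν₁ at jν eν
  -- The jets of the ingredients of the metric and the form. Those in `obtain` are kept opaque,
  -- so that the terms stay small until the last `simp`.
  obtain ⟨Ja, ja, ea⟩ : ∃ J, HasJet2 f.a p J ∧ J = ⟨0, ![0, ν₁, l], ![![0, 0, 0],
      ![0, ν₂, l₁],
      ![0, l₁, 0]]⟩ := by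
    have := (jl.mul jz).add jν
    exact ⟨_, HasJet2.of_eq this (by simp [Jet2.ofY, Jet2.coord, hx, hz] <;> ring)
      (fun i => by fin_cases i <;> simp [Jet2.ofY, Jet2.coord, hx, hz] <;> ring)
      (fun i j => by
        fin_cases i <;> fin_cases j <;> simp [Jet2.ofY, Jet2.coord, hx, hz] <;> ring), rfl⟩
  have jb : HasJet2 f.b p ⟨0, ![0, 0, -1], ![![0, ν₁, 0],
      ![ν₁, 0, μ₁],
      ![0, μ₁, 0]]⟩ := by
    have := (jμ.mul jz).add (jx.mul jν)
    exact HasJet2.of_eq this (by simp [Jet2.ofY, Jet2.coord, hx, hz, ea] <;> ring)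
      (fun i => by fin_cases i <;> simp [Jet2.ofY, Jet2.coord, hx, hz, ea] <;> ring)
      (fun i j => by
        fin_cases i <;> fin_cases j <;> simp [Jet2.ofY, Jet2.coord, hx, hz, ea] <;> ring)
  obtain ⟨Jw, jw, ew⟩ : ∃ J, HasJet2 f.w p J ∧ J = ⟨1, ![l, -μ₁, 0], ![![0, l₁, 0],
      ![l₁, -μ₂, 0],
      ![0, 0, 0]]⟩ := by
    have := (jx.mul jl).sub jμ
    exact ⟨_, HasJet2.of_eq this (by simp [Jet2.ofY, Jet2.coord, hx, hz, ea] <;> ring)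
      (fun i => by fin_cases i <;> simp [Jet2.ofY, Jet2.coord, hx, hz, ea] <;> ring)
      (fun i j => by
        fin_cases i <;> fin_cases j <;> simp [Jet2.ofY, Jet2.coord, hx, hz, ea] <;> ring), rfl⟩
  have jqb : HasJet2 f.qb p ⟨-γ, ![-l * γ, -β * ν₁ + γ * μ₁ - γ₁, -l * β - 2 * α],
    ![![0, -l * γ₁ - l₁ * γ + 2 * α * ν₁, 0],
      ![-l * γ₁ - l₁ * γ + 2 * α * ν₁, -β * ν₂ - 2 * β₁ * ν₁ + γ * μ₂ + 2 * γ₁ * μ₁ - γ₂,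
        -l * β₁ - l₁ * β + 2 * α * μ₁ - 2 * α₁],
      ![0, -l * β₁ - l₁ * β + 2 * α * μ₁ - 2 * α₁, 0]]⟩ := by
    have := ((((HasJet2.const 2 p).mul jα).mul jb).sub (jβ.mul ja)).sub (jγ.mul jw)
    exact HasJet2.of_eq this (by simp [Jet2.ofY, Jet2.coord, hx, hz, ea, ew] <;> ring)
      (fun i => by fin_cases i <;> simp [Jet2.ofY, Jet2.coord, hx, hz, ea, ew] <;> ring)
      (fun i j => by
        fin_cases i <;> fin_cases j <;> simp [Jet2.ofY, Jet2.coord, hx, hz, ea, ew] <;> ring)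
  have jqa : HasJet2 f.qa p ⟨ε, ![l * ε, 2 * δ * ν₁ - ε * μ₁ + ε₁, 2 * l * δ + β],
    ![![0, l * ε₁ + l₁ * ε - β * ν₁, 0],
      ![l * ε₁ + l₁ * ε - β * ν₁, 2 * δ * ν₂ + 4 * δ₁ * ν₁ - ε * μ₂ - 2 * ε₁ * μ₁ + ε₂,
        2 * l * δ₁ + 2 * l₁ * δ - β * μ₁ + β₁],
      ![0, 2 * l * δ₁ + 2 * l₁ * δ - β * μ₁ + β₁, 0]]⟩ := by
    have := ((((HasJet2.const 2 p).mul jδ).mul ja).sub (jβ.mul jb)).add (jε.mul jw)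
    exact HasJet2.of_eq this (by simp [Jet2.ofY, Jet2.coord, hx, hz, ea, ew] <;> ring)
      (fun i => by fin_cases i <;> simp [Jet2.ofY, Jet2.coord, hx, hz, ea, ew] <;> ring)
      (fun i j => by
        fin_cases i <;> fin_cases j <;> simp [Jet2.ofY, Jet2.coord, hx, hz, ea, ew] <;> ring)
  have jqw : HasJet2 f.qw p ⟨2 * ζ, ![2 * l * ζ, ε * ν₁ - 2 * ζ * μ₁ + 2 * ζ₁, l * ε + γ],
    ![![0, 2 * l * ζ₁ + 2 * l₁ * ζ - γ * ν₁, 0],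
      ![2 * l * ζ₁ + 2 * l₁ * ζ - γ * ν₁, ε * ν₂ + 2 * ε₁ * ν₁ - 2 * ζ * μ₂ - 4 * ζ₁ * μ₁ + 2 * ζ₂,
        l * ε₁ + l₁ * ε - γ * μ₁ + γ₁],
      ![0, l * ε₁ + l₁ * ε - γ * μ₁ + γ₁, 0]]⟩ := by
    have := ((jε.mul ja).add (((HasJet2.const 2 p).mul jζ).mul jw)).sub (jγ.mul jb)
    exact HasJet2.of_eq this (by simp [Jet2.ofY, Jet2.coord, hx, hz, ea, ew] <;> ring)
      (fun i => by fin_cases i <;> simp [Jet2.ofY, Jet2.coord, hx, hz, ea, ew] <;> ring)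
      (fun i j => by
        fin_cases i <;> fin_cases j <;> simp [Jet2.ofY, Jet2.coord, hx, hz, ea, ew] <;> ring)
  obtain ⟨J00, j00, e00⟩ : ∃ J, HasJet2 (fun q => f.a q * f.a q) p J ∧ J = ⟨0, ![0, 0, 0],
    ![![0, 0, 0],
      ![0, 2 * ν₁ ^ 2, 2 * l * ν₁],
      ![0, 2 * l * ν₁, 2 * l ^ 2]]⟩ := by
    have := ja.mul ja
    exact ⟨_, HasJet2.of_eq this (by simp [Jet2.ofY, Jet2.coord, hx, hz, ea, ew] <;> ring)
      (fun i => by fin_cases i <;> simp [Jet2.ofY, Jet2.coord, hx, hz, ea, ew] <;> ring)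
      (fun i j => by
        fin_cases i <;> fin_cases j <;> simp [Jet2.ofY, Jet2.coord, hx, hz, ea, ew] <;> ring), rfl⟩
  obtain ⟨J01, j01, e01⟩ : ∃ J, HasJet2 (fun q => f.qw q - q 2 * f.qb q) p J ∧ J = ⟨2 * ζ,
    ![2 * l * ζ, ε * ν₁ - 2 * ζ * μ₁ + 2 * ζ₁, l * ε + 2 * γ],
    ![![0, 2 * l * ζ₁ + 2 * l₁ * ζ - γ * ν₁, l * γ],
      ![2 * l * ζ₁ + 2 * l₁ * ζ - γ * ν₁, ε * ν₂ + 2 * ε₁ * ν₁ - 2 * ζ * μ₂ - 4 * ζ₁ * μ₁ + 2 * ζ₂,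
        l * ε₁ + l₁ * ε + β * ν₁ - 2 * γ * μ₁ + 2 * γ₁],
      ![l * γ, l * ε₁ + l₁ * ε + β * ν₁ - 2 * γ * μ₁ + 2 * γ₁, 2 * l * β + 4 * α]]⟩ := by
    have := jqw.sub (jz.mul jqb)
    exact ⟨_, HasJet2.of_eq this (by simp [Jet2.ofY, Jet2.coord, hx, hz, ea, ew] <;> ring)
      (fun i => by fin_cases i <;> simp [Jet2.ofY, Jet2.coord, hx, hz, ea, ew] <;> ring)
      (fun i j => by
        fin_cases i <;> fin_cases j <;> simp [Jet2.ofY, Jet2.coord, hx, hz, ea, ew] <;> ring), rfl⟩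
  obtain ⟨J02, j02, e02⟩ : ∃ J, HasJet2 (fun q => -(f.a q * f.w q)) p J ∧ J = ⟨0, ![0, -ν₁, -l],
    ![![0, -l * ν₁, -l ^ 2],
      ![-l * ν₁, 2 * μ₁ * ν₁ - ν₂, l * μ₁ - l₁],
      ![-l ^ 2, l * μ₁ - l₁, 0]]⟩ := by
    have := (ja.mul jw).neg
    exact ⟨_, HasJet2.of_eq this (by simp [Jet2.ofY, Jet2.coord, hx, hz, ea, ew] <;> ring)
      (fun i => by fin_cases i <;> simp [Jet2.ofY, Jet2.coord, hx, hz, ea, ew] <;> ring)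
      (fun i j => by
        fin_cases i <;> fin_cases j <;> simp [Jet2.ofY, Jet2.coord, hx, hz, ea, ew] <;> ring), rfl⟩
  obtain ⟨J12, j12, e12⟩ : ∃ J, HasJet2 (fun q => q 0 * f.qb q + f.qa q) p J ∧ J = ⟨ε,
    ![l * ε - γ, 2 * δ * ν₁ - ε * μ₁ + ε₁, 2 * l * δ + β],
    ![![-2 * l * γ, l * ε₁ + l₁ * ε - 2 * β * ν₁ + γ * μ₁ - γ₁, -l * β - 2 * α],
      ![l * ε₁ + l₁ * ε - 2 * β * ν₁ + γ * μ₁ - γ₁,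
        2 * δ * ν₂ + 4 * δ₁ * ν₁ - ε * μ₂ - 2 * ε₁ * μ₁ + ε₂,
        2 * l * δ₁ + 2 * l₁ * δ - β * μ₁ + β₁],
      ![-l * β - 2 * α, 2 * l * δ₁ + 2 * l₁ * δ - β * μ₁ + β₁, 0]]⟩ := by
    have := (jx.mul jqb).add jqa
    exact ⟨_, HasJet2.of_eq this (by simp [Jet2.ofY, Jet2.coord, hx, hz, ea, ew] <;> ring)
      (fun i => by fin_cases i <;> simp [Jet2.ofY, Jet2.coord, hx, hz, ea, ew] <;> ring)
      (fun i j => by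
        fin_cases i <;> fin_cases j <;> simp [Jet2.ofY, Jet2.coord, hx, hz, ea, ew] <;> ring), rfl⟩
  obtain ⟨J22, j22, e22⟩ : ∃ J, HasJet2 (fun q => f.w q * f.w q) p J ∧ J = ⟨1,
    ![2 * l, -2 * μ₁, 0], ![![2 * l ^ 2, -2 * l * μ₁ + 2 * l₁, 0],
      ![-2 * l * μ₁ + 2 * l₁, 2 * μ₁ ^ 2 - 2 * μ₂, 0],
      ![0, 0, 0]]⟩ := by
    have := jw.mul jw
    exact ⟨_, HasJet2.of_eq this (by simp [Jet2.ofY, Jet2.coord, hx, hz, ea, ew] <;> ring)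
      (fun i => by fin_cases i <;> simp [Jet2.ofY, Jet2.coord, hx, hz, ea, ew] <;> ring)
      (fun i j => by
        fin_cases i <;> fin_cases j <;> simp [Jet2.ofY, Jet2.coord, hx, hz, ea, ew] <;> ring), rfl⟩
  obtain ⟨J11, j11, e11⟩ : ∃ J, HasJet2 f.dualq p J ∧ J = ⟨-4 * δ * ζ + ε ^ 2,
    ![4 * β * ζ - 2 * γ * ε, -4 * δ * ζ₁ - 4 * δ₁ * ζ + 2 * ε * ε₁, 2 * β * ε - 4 * γ * δ],
    ![![-8 * α * ζ + 2 * γ ^ 2, 4 * β * ζ₁ + 4 * β₁ * ζ - 2 * γ * ε₁ - 2 * γ₁ * ε,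
    -4 * α * ε + 2 * β * γ],
      ![4 * β * ζ₁ + 4 * β₁ * ζ - 2 * γ * ε₁ - 2 * γ₁ * ε,
        -4 * δ * ζ₂ - 8 * δ₁ * ζ₁ - 4 * δ₂ * ζ + 2 * ε * ε₂ + 2 * ε₁ ^ 2,
        2 * β * ε₁ + 2 * β₁ * ε - 4 * γ * δ₁ - 4 * γ₁ * δ],
      ![-4 * α * ε + 2 * β * γ, 2 * β * ε₁ + 2 * β₁ * ε - 4 * γ * δ₁ - 4 * γ₁ * δ,
        -8 * α * δ + 2 * β ^ 2]]⟩ := by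
    have := ((((((jε.mul jε).sub (((HasJet2.const 4 p).mul jδ).mul jζ)).add
      (((((HasJet2.const 4 p).mul jβ).mul jζ).sub (((HasJet2.const 2 p).mul jγ).mul jε)).mul jx)).add
      (((((HasJet2.const 2 p).mul jβ).mul jε).sub (((HasJet2.const 4 p).mul jγ).mul jδ)).mul jz)).add
      (((jγ.mul jγ).sub (((HasJet2.const 4 p).mul jα).mul jζ)).mul (jx.mul jx))).add
      (((((HasJet2.const 2 p).mul jβ).mul jγ).sub (((HasJet2.const 4 p).mul jα).mul jε)).mul (jx.mul jz))).add
      (((jβ.mul jβ).sub (((HasJet2.const 4 p).mul jα).mul jδ)).mul (jz.mul jz))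
    exact ⟨_, HasJet2.of_eq this (by simp [Jet2.ofY, Jet2.coord, hx, hz, ea, ew] <;> ring)
      (fun i => by fin_cases i <;> simp [Jet2.ofY, Jet2.coord, hx, hz, ea, ew] <;> ring)
      (fun i j => by
        fin_cases i <;> fin_cases j <;> simp [Jet2.ofY, Jet2.coord, hx, hz, ea, ew] <;> ring), rfl⟩
  have jP : HasJet1 f.bigPi p ⟨ζ, ![2 * l * ζ, ε * ν₁ - 2 * ζ * μ₁ + ζ₁, l * ε + γ]⟩ := by
    rw [ea] at ja
    rw [ew] at jw
    have := ((((((jα.mul (jb.mul jb)).sub (jβ.mul (ja.mul jb))).add (jδ.mul (ja.mul ja))).add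
      (jε.mul (jw.mul ja))).add (jζ.mul (jw.mul jw))).sub (jγ.mul (jw.mul jb))).toJet1
    refine (this.congr (.of_forall f.bigPi_eq)).of_eq (by simp [Jet2.ofY, Jet2.coord, hx, hz])
      fun i => by fin_cases i <;> simp [Jet2.ofY, Jet2.coord, hx, hz] <;> ring
  have j3 : HasJet1 f.coeff3 p ⟨γ + ν₁, ![l * γ + l * ν₁, β * ν₁ - γ * μ₁ + γ₁ + ν₂,
    l * β + l * μ₁ + l₁ + 2 * α]⟩ := by
    rw [ea] at ja
    rw [ew] at jw
    have := ((jqb.neg.toJet1.add (jw.toJet1.mul eν)).add (eμ.mul ja.toJet1)).sub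
      (el.mul jb.toJet1)
    refine (this.congr (.of_forall f.coeff3_eq)).of_eq (by simp [Jet2.ofY, Jet2.coord, hx, hz])
      fun i => by fin_cases i <;> simp [Jet2.ofY, Jet2.coord, hx, hz] <;> ring
  obtain ⟨C, j2, eC⟩ : ∃ J, HasJet1 f.coeff2 p J ∧ J = ⟨-β - μ₁, ![l₁ + 2 * α, -β₁ - μ₂, 0]⟩ := by
    have := (((((HasJet2.const 2 p).mul jx).mul jα).sub jβ).toJet1.add (jx.toJet1.mul el)).sub eμ
    exact ⟨_, HasJet1.of_eq this (by simp [Jet2.ofY, Jet2.coord, hx, hz])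
      (fun i => by fin_cases i <;> simp [Jet2.ofY, Jet2.coord, hx, hz] <;> ring), rfl⟩
  obtain ⟨K, jk, eK⟩ : ∃ J, HasJet1 (fun q => f.coeff3 q / (2 * f.bigPi q)) p J ∧
      J = ⟨(γ + ν₁) / (2 * ζ), ![(-l * γ * ζ - l * ζ * ν₁) / (2 * ζ ^ 2),
        (β * ζ * ν₁ - γ * ε * ν₁ + γ * ζ * μ₁ - γ * ζ₁ + γ₁ * ζ - ε * ν₁ ^ 2 + 2 * ζ * μ₁ * ν₁
        + ζ * ν₂ - ζ₁ * ν₁) / (2 * ζ ^ 2),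
        (l * β * ζ - l * γ * ε - l * ε * ν₁ + l * ζ * μ₁ + l₁ * ζ + 2 * α * ζ - γ * ν₁
        - γ ^ 2) / (2 * ζ ^ 2)]⟩ :=
    ⟨_, (j3.div ((HasJet1.const 2 p).mul jP) (by simpa using hζ)).of_eq (by simp)
      (fun i => by fin_cases i <;> simp <;> field_simp <;> ring), rfl⟩
  have hm : ∀ᶠ q in 𝓝 p, f.metric q = f.polyMetric q :=
    hdom.mono fun q hq => metric_eq_polyMetric f hq.1
  have hf := hdom.mono fun q hq => form_eq f hq
  have hG : ∀ i j, HasJet2 (fun q => f.metric q i j) p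
      (![![J00, J01, J02], ![J01, J11, J12], ![J02, J12, J22]] i j) := by
    intro i j
    have e : (fun q => f.metric q i j) =ᶠ[𝓝 p] fun q => f.polyMetric q i j :=
      hm.mono fun q hq => congrFun (congrFun hq i) j
    fin_cases i <;> fin_cases j
    exacts [j00.congr e, j01.congr e, j02.congr e, j01.congr e, j11.congr e, j12.congr e,
      j02.congr e, j12.congr e, j22.congr e]
  have hB : ∀ i, HasJet1 (fun q => f.form q i) p (![-(Ja.toJet1 * K),
      (J12.toJet1 * K + C) / Jw.toJet1, Jw.toJet1 * K] i) := by
    intro i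
    have e : (fun q => f.form q i) =ᶠ[𝓝 p] fun q => _ := hf.mono fun q hq => congrFun hq i
    fin_cases i
    exacts [(ja.toJet1.mul jk).neg.congr e,
      (((j12.toJet1.mul jk).add j2).div jw.toJet1 (by simp [ew])).congr e,
      (jw.toJet1.mul jk).congr e]
  -- The inverse metric and the Weyl connection at the point.
  have R := ricci_weylConn_of_jets (fun q => metric_symm f q) hG hB hAc
    (gi := !![δ / ζ, 1 / (2 * ζ), -ε / (2 * ζ); 1 / (2 * ζ), 0, 0; -ε / (2 * ζ), 0, 1])
    (Γ := ![![![l, β - γ * ε / (4 * ζ) - ε * ν₁ / (4 * ζ), -γ / (4 * ζ) - ν₁ / (4 * ζ)],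
      ![β - γ * ε / (4 * ζ) - ε * ν₁ / (4 * ζ), δ * ζ₁ / ζ - δ₁,
      γ * δ / (2 * ζ) - δ * ν₁ / (2 * ζ)], ![-γ / (4 * ζ) - ν₁ / (4 * ζ),
      γ * δ / (2 * ζ) - δ * ν₁ / (2 * ζ), -l * δ / ζ]],
        ![![0, 0, 0], ![0, β - γ * ε / (2 * ζ) - ε * ν₁ / (2 * ζ) + ζ₁ / ζ + μ₁,
          γ / (4 * ζ) - 3 * ν₁ / (4 * ζ)], ![0, γ / (4 * ζ) - 3 * ν₁ / (4 * ζ), -l / ζ]],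
        ![![0, -γ / 2 + ν₁ / 2, l], ![-γ / 2 + ν₁ / 2, -ε * ζ₁ / ζ + ε₁,
          β - 3 * γ * ε / (4 * ζ) + ε * ν₁ / (4 * ζ)],
          ![l, β - 3 * γ * ε / (4 * ζ) + ε * ν₁ / (4 * ζ),
          l * ε / ζ - γ / (2 * ζ) - ν₁ / (2 * ζ)]]])
    (by
      ext i j
      fin_cases i <;> fin_cases j <;>
        simp [Matrix.mul_apply, Fin.sum_univ_three, e00, e01, e02, e11, e12, e22] <;>
        field_simp <;> ring)
    (by intro i j k; fin_cases i <;> fin_cases j <;> fin_cases k <;> rfl)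
    (by
      intro k i j
      fin_cases k <;> fin_cases i <;> fin_cases j <;>
        simp [Fin.sum_univ_three, e00, e01, e02, e11, e12, e22, ea, ew, eK, eC] <;>
        field_simp <;> ring)
  refine ⟨-(γ + ν₁) ^ 2 / (8 * ζ ^ 2), fun i j => ?_⟩
  rw [(hG i j).val, ricciSym, R, R]
  fin_cases i <;> fin_cases j <;>
    simp [Fin.sum_univ_three, e00, e01, e02, e11, e12, e22, ea, ew, eK, eC] <;>
    field_simp <;> ring

/-- The Einstein--Weyl equations hold at every point of the domain: an affine change of the
coordinates `x, z` and a homothety take the point to a normalized one. -/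
theorem einsteinWeylAt {f : Coeffs} (h : f.IsContDiff 2) {p : Pt} (hp : p ∈ f.domain) :
    EinsteinWeylAt f.metric f.form p := by
  set c := f.a p / f.w p with hc
  set r := (f.w p)⁻¹ with hr
  have hw : f.w p ≠ 0 := hp.1
  have hr0 : r ≠ 0 := inv_ne_zero hw
  set q : Pt := ![0, p 1, 0] with hq
  have hs : shear (p 0) (p 2) c q = p := by
    funext i
    fin_cases i <;> simp [shear, hq]
  have hqd : q ∈ (f.affine (p 0) (p 2) c r).domain := by
    rw [mem_domain_affine hr0, hs]; exact hp
  have hw' : f.μ (p 1) - p 0 * f.lam (p 1) = -f.w p := by simp [w]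
  have key := einsteinWeylAt_of_normalized (h.affine (p 0) (p 2) c r) (p := q) rfl rfl
    (by
      simp only [affine, hq, Matrix.cons_val, hw']
      have hca : c * f.w p = f.lam (p 1) * p 2 + f.ν (p 1) := div_mul_cancel₀ _ hw
      linear_combination (-r) * hca)
    (by
      simp only [affine, hq, Matrix.cons_val, hw', hr]
      field_simp)
    hqd
  rw [metric_affine f _ _ _ hr0, form_affine (h.of_le (by norm_num)) _ _ _ hr0] at key
  have hdom : ∀ᶠ q in 𝓝 p, q ∈ f.domain := (isOpen_domain h).mem_nhds hp
  have res := key.of_pull (pow_ne_zero 2 hr0) (g := f.metric) (A := f.form)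
    (by
      rw [hs]
      filter_upwards [hdom] with q hq i j
      exact (contDiffAt_metric h hq.1 i j).differentiableAt (by simp))
    (by
      rw [hs]
      intro i j k
      refine (contDiffAt_weylConn (m := 1) (contDiffAt_metric h hw) (by norm_num)
        (contDiffAt_form (n := 1) (h.of_le (by norm_num)) hp) ?_ i j k).differentiableAt (by simp)
      rw [det_metric f hw]
      simpa using hp.2)
  rwa [hs] at res

theorem isLorentzianEinsteinWeylOn {n : ℕ∞} {f : Coeffs} (hn : 1 ≤ n) (h : f.IsContDiff (n + 1)) :
    IsLorentzianEinsteinWeylOn n f.domain f.metric f.form where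
  isOpen := isOpen_domain h
  contDiffOn_metric i j := fun _ hp => (contDiffAt_metric h hp.1 i j).contDiffWithinAt
  contDiffOn_form i := fun _ hp => (contDiffAt_form h hp i).contDiffWithinAt
  lorentzian _ hp := isLorentzian_metric f hp
  einsteinWeyl p hp i j := by
    have h2 : f.IsContDiff 2 := h.of_le (by
      have : (1 : WithTop ℕ∞) ≤ n := by exact_mod_cast hn
      calc (2 : WithTop ℕ∞) = 1 + 1 := by norm_num
        _ ≤ n + 1 := by gcongr)
    refine (einsteinWeylAt h2 hp).traceFree (f.metric_symm p) ?_ i j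
    rw [det_metric f hp.1]
    simpa using hp.2

end Coeffs

end EinsteinWeyl

open scoped Matrix ContDiff Topology Polynomial

namespace EinsteinWeyl

/-! ### Families of functions that are rational in a parameter -/

/-- `u t` is, for every `q`, the value at `t` of a polynomial of bounded degree, whose
coefficients are functions of `q` of class `Cᵏ`. -/
def IsPolyFamily (k : ℕ) (u : ℝ → Pt → ℝ) : Prop :=
  ∃ (d : ℕ) (c : Pt → ℝ[X]), (∀ q, (c q).natDegree ≤ d) ∧
    (∀ i, ContDiff ℝ k fun q => (c q).coeff i) ∧ ∀ t q, u t q = (c q).eval t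

namespace IsPolyFamily

variable {k : ℕ} {u v : ℝ → Pt → ℝ}

lemma of_contDiff {s : Pt → ℝ} (hs : ContDiff ℝ k s) : IsPolyFamily k fun _ => s :=
  ⟨0, fun q => Polynomial.C (s q), fun q => by simp, fun i => by
    rcases eq_or_ne i 0 with rfl | h
    · simpa using hs
    · simpa [Polynomial.coeff_C, h] using contDiff_const, fun t q => by simp⟩

lemma param (k : ℕ) : IsPolyFamily k fun t _ => t :=
  ⟨1, fun _ => Polynomial.X, fun _ => by simp, fun i => contDiff_const, fun t q => by simp⟩

lemma add (hu : IsPolyFamily k u) (hv : IsPolyFamily k v) :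
    IsPolyFamily k fun t q => u t q + v t q := by
  obtain ⟨d, c, hd, hc, hu⟩ := hu
  obtain ⟨d', c', hd', hc', hv⟩ := hv
  refine ⟨max d d', fun q => c q + c' q, fun q => (Polynomial.natDegree_add_le _ _).trans
    (max_le_max (hd q) (hd' q)), fun i => ?_, fun t q => by simp [hu, hv]⟩
  simp only [Polynomial.coeff_add]
  exact (hc i).add (hc' i)

lemma mul (hu : IsPolyFamily k u) (hv : IsPolyFamily k v) :
    IsPolyFamily k fun t q => u t q * v t q := by
  obtain ⟨d, c, hd, hc, hu⟩ := hu
  obtain ⟨d', c', hd', hc', hv⟩ := hv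
  refine ⟨d + d', fun q => c q * c' q, fun q => Polynomial.natDegree_mul_le.trans
    (add_le_add (hd q) (hd' q)), fun i => ?_, fun t q => by simp [hu, hv]⟩
  simp only [Polynomial.coeff_mul]
  exact ContDiff.sum fun x _ => (hc x.1).mul (hc' x.2)

lemma const (k : ℕ) (r : ℝ) : IsPolyFamily k fun _ _ => r := of_contDiff contDiff_const

lemma neg (hu : IsPolyFamily k u) : IsPolyFamily k fun t q => -u t q := by
  simpa using (const k (-1)).mul hu

lemma sub (hu : IsPolyFamily k u) (hv : IsPolyFamily k v) :
    IsPolyFamily k fun t q => u t q - v t q := by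
  simpa [sub_eq_add_neg] using hu.add hv.neg

lemma pow (hu : IsPolyFamily k u) (n : ℕ) : IsPolyFamily k fun t q => u t q ^ n := by
  induction n with
  | zero => simpa using const k 1
  | succ n ih => simpa [pow_succ] using ih.mul hu

lemma of_le {k' : ℕ} (hu : IsPolyFamily k u) (h : k' ≤ k) : IsPolyFamily k' u := by
  obtain ⟨d, c, hd, hc, hu⟩ := hu
  exact ⟨d, c, hd, fun i => (hc i).of_le (by exact_mod_cast h), hu⟩

lemma eq_sum {d : ℕ} {c : Pt → ℝ[X]} (hd : ∀ q, (c q).natDegree ≤ d)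
    (hu : ∀ t q, u t q = (c q).eval t) (t : ℝ) :
    u t = fun q => ∑ i ∈ Finset.range (d + 1), (c q).coeff i * t ^ i := by
  funext q
  rw [hu, Polynomial.eval_eq_sum_range' (Nat.lt_succ_of_le (hd q))]

lemma contDiff (hu : IsPolyFamily k u) (t : ℝ) : ContDiff ℝ k (u t) := by
  obtain ⟨d, c, hd, hc, hu⟩ := hu
  rw [eq_sum hd hu]
  exact ContDiff.sum fun i _ => (hc i).mul contDiff_const

lemma pd (hu : IsPolyFamily (k + 1) u) (j : Fin 3) : IsPolyFamily k fun t q => pd j (u t) q := by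
  obtain ⟨d, c, hd, hc, hu⟩ := hu
  refine ⟨d, fun q => ∑ i ∈ Finset.range (d + 1),
    Polynomial.monomial i (EinsteinWeyl.pd j (fun q => (c q).coeff i) q), fun q => ?_, fun i => ?_,
    fun t q => ?_⟩
  · refine Polynomial.natDegree_sum_le_of_forall_le _ _ fun i hi => ?_
    exact (Polynomial.natDegree_monomial_le _).trans (Nat.lt_succ_iff.1 (Finset.mem_range.1 hi))
  · simp only [Polynomial.finsetSum_coeff, Polynomial.coeff_monomial]
    refine ContDiff.sum fun m _ => ?_
    by_cases h : m = i
    · simp only [h, if_true]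
      exact contDiff_pd (hc i) (by norm_cast) j
    · simp only [h, if_false]
      exact contDiff_const
  · dsimp only
    rw [eq_sum hd hu, pd_sum _ fun i _ => ?_]
    · simp only [Polynomial.eval_finsetSum, Polynomial.eval_monomial]
      refine Finset.sum_congr rfl fun i _ => ?_
      have : (fun q => (c q).coeff i * t ^ i) = fun q => t ^ i * (c q).coeff i := by
        funext q; ring
      rw [this, pd_const_mul, mul_comm]
    · exact (((hc i).mul contDiff_const).differentiable (by simp)).differentiableAt

end IsPolyFamily

/-- `u t` agrees with the quotient of a polynomial family by a power of `S t`, wherever the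
latter does not vanish. -/
def IsRatFamily (S : ℝ → Pt → ℝ) (k : ℕ) (u : ℝ → Pt → ℝ) : Prop :=
  ∃ (m : ℕ) (v : ℝ → Pt → ℝ), IsPolyFamily k v ∧ ∀ t q, S t q ≠ 0 → u t q = v t q / S t q ^ m

lemma IsPolyFamily.isRatFamily {S : ℝ → Pt → ℝ} {k : ℕ} {u : ℝ → Pt → ℝ}
    (hu : IsPolyFamily k u) : IsRatFamily S k u :=
  ⟨0, u, hu, fun t q _ => by simp⟩

namespace IsRatFamily

variable {S : ℝ → Pt → ℝ} {k : ℕ} {u v : ℝ → Pt → ℝ}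

lemma congr (hu : IsRatFamily S k u) (h : ∀ t q, S t q ≠ 0 → v t q = u t q) :
    IsRatFamily S k v := by
  obtain ⟨m, w, hw, e⟩ := hu
  exact ⟨m, w, hw, fun t q hS => (h t q hS).trans (e t q hS)⟩

lemma of_le {k' : ℕ} (hu : IsRatFamily S k u) (h : k' ≤ k) : IsRatFamily S k' u := by
  obtain ⟨m, w, hw, e⟩ := hu
  exact ⟨m, w, hw.of_le h, e⟩

lemma const (r : ℝ) : IsRatFamily S k fun _ _ => r := (IsPolyFamily.const k r).isRatFamily

lemma mul (hu : IsRatFamily S k u) (hv : IsRatFamily S k v) :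
    IsRatFamily S k fun t q => u t q * v t q := by
  obtain ⟨m, a, ha, e⟩ := hu
  obtain ⟨m', b, hb, e'⟩ := hv
  exact ⟨m + m', _, ha.mul hb, fun t q hS => by
    dsimp only
    rw [e t q hS, e' t q hS, pow_add, div_mul_div_comm]⟩

lemma add (hS : IsPolyFamily k S) (hu : IsRatFamily S k u) (hv : IsRatFamily S k v) :
    IsRatFamily S k fun t q => u t q + v t q := by
  obtain ⟨m, a, ha, e⟩ := hu
  obtain ⟨m', b, hb, e'⟩ := hv
  refine ⟨m + m', _, (ha.mul (hS.pow m')).add ((hS.pow m).mul hb), fun t q h => ?_⟩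
  dsimp only
  rw [e t q h, e' t q h, pow_add, div_add_div _ _ (pow_ne_zero _ h) (pow_ne_zero _ h)]

lemma neg (hu : IsRatFamily S k u) : IsRatFamily S k fun t q => -u t q := by
  simpa using (const (-1)).mul hu

lemma sub (hS : IsPolyFamily k S) (hu : IsRatFamily S k u) (hv : IsRatFamily S k v) :
    IsRatFamily S k fun t q => u t q - v t q := by
  simpa [sub_eq_add_neg] using hu.add hS hv.neg

lemma sum (hS : IsPolyFamily k S) {ι : Type*} (s : Finset ι) {u : ι → ℝ → Pt → ℝ}
    (hu : ∀ i, IsRatFamily S k (u i)) : IsRatFamily S k fun t q => ∑ i ∈ s, u i t q := by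
  classical
  induction s using Finset.induction_on with
  | empty => simpa using const 0
  | insert a s ha ih => simpa [Finset.sum_insert ha] using (hu a).add hS ih

/-- Division by a polynomial family that divides the power `S ^ n`. -/
lemma div_of_mul_eq {w : ℝ → Pt → ℝ} (hu : IsRatFamily S k u) (hv : IsPolyFamily k v) (n : ℕ)
    (h : ∀ t q, S t q ≠ 0 → w t q * v t q = S t q ^ n) :
    IsRatFamily S k fun t q => u t q / w t q := by
  have h1 : IsRatFamily S k fun t q => v t q / S t q ^ n := ⟨n, v, hv, fun _ _ _ => rfl⟩
  refine (hu.mul h1).congr fun t q hS => ?_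
  have h2 : w t q * v t q ≠ 0 := by rw [h t q hS]; exact pow_ne_zero _ hS
  rw [← h t q hS]
  have := left_ne_zero_of_mul h2
  have := right_ne_zero_of_mul h2
  field_simp

lemma pd (hS : IsPolyFamily (k + 1) S) (hu : IsRatFamily S (k + 1) u) (j : Fin 3) :
    IsRatFamily S k fun t q => pd j (u t) q := by
  obtain ⟨m, v, hv, e⟩ := hu
  refine ⟨m * 2, _, ((hv.pd j).mul ((hS.of_le k.le_succ).pow m)).sub
    ((hv.of_le k.le_succ).mul ((hS.pow m).pd j)), fun t q h => ?_⟩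
  have h1 : u t =ᶠ[𝓝 q] fun q => v t q / S t q ^ m := by
    have hc : ContinuousAt (S t) q := (hS.contDiff t).continuous.continuousAt
    filter_upwards [hc.eventually_ne h] with q' hq'
    exact e t q' hq'
  dsimp only
  rw [pd_congr h1, pd_div ((hv.contDiff t).differentiable (by simp)).differentiableAt
    (((hS.pow m).contDiff t).differentiable (by simp)).differentiableAt (pow_ne_zero _ h), pow_mul]

/-- A rational function of the parameter that does not vanish identically has no zeros near `0`,
except possibly `0` itself. -/
lemma eventually_ne (hS : IsPolyFamily k S) (hu : IsRatFamily S k u) {p : Pt} {t₀ : ℝ}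
    (h1 : S t₀ p ≠ 0) (h2 : u t₀ p ≠ 0) :
    ∀ᶠ t in 𝓝[≠] (0 : ℝ), S t p ≠ 0 ∧ u t p ≠ 0 := by
  obtain ⟨m, v, ⟨d, c, -, -, hv⟩, e⟩ := hu
  obtain ⟨d', c', -, -, hS'⟩ := hS
  have hc' : c' p ≠ 0 := fun h => h1 (by simp [hS', h])
  have hc : c p ≠ 0 := fun h => h2 (by simp [e t₀ p h1, hv, h])
  have hev : ∀ᶠ t in 𝓝[≠] (0 : ℝ), t ∉ (c p * c' p).roots.toFinset :=
    nhdsNE_le_cofinite 0 (Finset.finite_toSet _).compl_mem_cofinite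
  filter_upwards [hev] with t ht
  have ht' : (c p).eval t ≠ 0 ∧ (c' p).eval t ≠ 0 := by
    simpa [hc, hc'] using ht
  have hSt : S t p ≠ 0 := by rw [hS']; exact ht'.2
  refine ⟨hSt, ?_⟩
  rw [e t p hSt, hv]
  exact div_ne_zero ht'.1 (pow_ne_zero _ hSt)

end IsRatFamily

/-! ### Curvature of rational families of metrics -/

section

variable {S : ℝ → Pt → ℝ} {g : ℝ → Metric}

lemma isRatFamily_leviCivita {k : ℕ} (hS : IsPolyFamily (k + 1) S)
    (hg : ∀ i j, IsRatFamily S (k + 1) fun t q => g t q i j)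
    (hi : ∀ i j, IsRatFamily S k fun t q => (g t q)⁻¹ i j) (i j l : Fin 3) :
    IsRatFamily S k fun t q => leviCivita (g t) q i j l := by
  have hS' := hS.of_le k.le_succ
  have hd : ∀ m i j, IsRatFamily S k fun t q => pd m (fun q => g t q i j) q :=
    fun m i j => (hg i j).pd hS m
  simp only [leviCivita, weylConn, weylConnLow, Pi.zero_apply, zero_mul, add_zero, sub_zero,
    div_eq_mul_inv]
  exact IsRatFamily.sum hS' _ fun m => (hi i m).mul
    ((((hd _ _ _).add hS' (hd _ _ _)).sub hS' (hd _ _ _)).mul (.const _))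

lemma isRatFamily_ricci {k : ℕ} (hS : IsPolyFamily (k + 1) S) {Γ : ℝ → Conn}
    (hΓ : ∀ i j l, IsRatFamily S (k + 1) fun t q => Γ t q i j l) (i j : Fin 3) :
    IsRatFamily S k fun t q => ricci (Γ t) q i j := by
  have hS' := hS.of_le k.le_succ
  have hΓ' : ∀ i j l, IsRatFamily S k fun t q => Γ t q i j l := fun i j l =>
    (hΓ i j l).of_le k.le_succ
  have hd : ∀ m i j l, IsRatFamily S k fun t q => pd m (fun q => Γ t q i j l) q :=
    fun m i j l => (hΓ i j l).pd hS m
  unfold ricci curv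
  exact IsRatFamily.sum hS' _ fun m => ((hd _ _ _ _).sub hS' (hd _ _ _ _)).add hS'
    (IsRatFamily.sum hS' _ fun n => ((hΓ' _ _ _).mul (hΓ' _ _ _)).sub hS'
      ((hΓ' _ _ _).mul (hΓ' _ _ _)))

lemma isRatFamily_cotton (hS : IsPolyFamily 3 S)
    (hg : ∀ i j, IsRatFamily S 3 fun t q => g t q i j)
    (hi : ∀ i j, IsRatFamily S 3 fun t q => (g t q)⁻¹ i j) (i j l : Fin 3) :
    IsRatFamily S 0 fun t q => cotton (g t) q i j l := by
  have hS2 : IsPolyFamily 2 S := hS.of_le (by norm_num)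
  have hS1 : IsPolyFamily 1 S := hS.of_le (by norm_num)
  have hS0 : IsPolyFamily 0 S := hS.of_le (by norm_num)
  have hΓ : ∀ i j l, IsRatFamily S 2 fun t q => leviCivita (g t) q i j l :=
    isRatFamily_leviCivita hS hg fun i j => (hi i j).of_le (by norm_num)
  have hR : ∀ i j, IsRatFamily S 1 fun t q => ricci (leviCivita (g t)) q i j :=
    isRatFamily_ricci hS2 hΓ
  have hs : IsRatFamily S 1 fun t q => scalar (g t) (leviCivita (g t)) q :=
    IsRatFamily.sum hS1 _ fun i => IsRatFamily.sum hS1 _ fun j =>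
      ((hi i j).of_le (by norm_num)).mul (hR i j)
  have hP : ∀ i j, IsRatFamily S 1 fun t q => schouten (g t) q i j := by
    intro i j
    unfold schouten
    simp only [div_eq_mul_inv]
    exact (hR i j).sub hS1 ((hs.mul (.const _)).mul ((hg i j).of_le (by norm_num)))
  have hP0 : ∀ i j, IsRatFamily S 0 fun t q => schouten (g t) q i j := fun i j =>
    (hP i j).of_le (by norm_num)
  have hΓ0 : ∀ i j l, IsRatFamily S 0 fun t q => leviCivita (g t) q i j l := fun i j l =>
    (hΓ i j l).of_le (by norm_num)
  have hN : ∀ i j l, IsRatFamily S 0 fun t q => nablaSchouten (g t) q i j l := by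
    intro i j l
    unfold nablaSchouten
    exact (((hP j l).pd hS1 i).sub hS0 (IsRatFamily.sum hS0 _ fun m =>
      (hΓ0 _ _ _).mul (hP0 _ _))).sub hS0 (IsRatFamily.sum hS0 _ fun m =>
      (hΓ0 _ _ _).mul (hP0 _ _))
  exact (hN _ _ _).sub hS0 (hN _ _ _)

end

/-! ### Invariance under homotheties -/

lemma cotton_smul {c : ℝ} (hc : c ≠ 0) (g : Metric) :
    cotton (fun q => c • g q) = cotton g := by
  have h1 : leviCivita (fun q => c • g q) = leviCivita g := weylConn_smul hc g 0
  have hi : ∀ q, (c • g q)⁻¹ = c⁻¹ • (g q)⁻¹ := inv_smul_metric hc g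
  have h2 : schouten (fun q => c • g q) = schouten g := by
    funext q i j
    have hsc : scalar (fun q => c • g q) (leviCivita g) q = c⁻¹ * scalar g (leviCivita g) q := by
      simp only [scalar, hi, Matrix.smul_apply, smul_eq_mul, Finset.mul_sum]
      exact Finset.sum_congr rfl fun _ _ => Finset.sum_congr rfl fun _ _ => by ring
    simp only [schouten, h1, hsc, Matrix.smul_apply, smul_eq_mul]
    field_simp
  funext q i j k
  simp only [cotton, nablaSchouten, h1, h2]

namespace Coeffs

lemma metric_homothety (f : Coeffs) {r : ℝ} (hr : r ≠ 0) :
    (f.affine 0 0 0 r).metric = fun q => r ^ 2 • f.metric q := by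
  have hs : ∀ q : Pt, shear 0 0 0 q = q := fun q => by
    funext i; fin_cases i <;> simp [shear]
  have hJ : shearJac 0 = 1 := by
    ext i j; fin_cases i <;> fin_cases j <;> simp [shearJac]
  rw [metric_affine f 0 0 0 hr]
  simp [Metric.pull, hs, hJ]

lemma form_homothety {f : Coeffs} (h : f.IsContDiff 1) {r : ℝ} (hr : r ≠ 0) :
    (f.affine 0 0 0 r).form = f.form := by
  have hs : ∀ q : Pt, shear 0 0 0 q = q := fun q => by
    funext i; fin_cases i <;> simp [shear]
  have hJ : shearJac 0 = 1 := by
    ext i j; fin_cases i <;> fin_cases j <;> simp [shearJac]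
  rw [form_affine h 0 0 0 hr]
  funext q
  simp [Form.pull, hs, hJ]

/-- The perturbation `f + s⁻¹ h` is `h + s f` up to the homothety with factor `s⁻¹`. -/
lemma perturb_inv (f h : Coeffs) {s : ℝ} (hs : s ≠ 0) :
    f.perturb h s⁻¹ = (h.perturb f s).affine 0 0 0 s⁻¹ := by
  simp only [perturb, affine, Coeffs.mk.injEq]
  refine ⟨?_, ?_, ?_, ?_, ?_, ?_, ?_, ?_, ?_⟩ <;> funext y <;> field_simp <;> ring

lemma perturb_zero (f h : Coeffs) : f.perturb h 0 = f := by
  simp [perturb]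

lemma IsContDiff.perturb {n : WithTop ℕ∞} {f h : Coeffs} (hf : f.IsContDiff n)
    (hh : h.IsContDiff n) (t : ℝ) : (f.perturb h t).IsContDiff n := by
  obtain ⟨h1, h2, h3, h4, h5, h6, h7, h8, h9⟩ := hf
  obtain ⟨k1, k2, k3, k4, k5, k6, k7, k8, k9⟩ := hh
  unfold Coeffs.perturb IsContDiff
  refine ⟨?_, ?_, ?_, ?_, ?_, ?_, ?_, ?_, ?_⟩ <;> dsimp only <;> fun_prop

/-! ### Dependence of the family on the perturbation parameter -/

/-- The function `w Π` of the perturbed coefficients, which vanishes exactly off the domain. -/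
def discr (f h : Coeffs) (t : ℝ) (q : Pt) : ℝ := (f.perturb h t).w q * (f.perturb h t).bigPi q

lemma discr_ne_zero {f h : Coeffs} {t : ℝ} {q : Pt} :
    discr f h t q ≠ 0 ↔ q ∈ (f.perturb h t).domain := mul_ne_zero_iff

lemma isPolyFamily_comp_y {k : ℕ} {s r : ℝ → ℝ} (hs : ContDiff ℝ k s) (hr : ContDiff ℝ k r) :
    IsPolyFamily k fun t q => s (q 1) + t * r (q 1) :=
  (IsPolyFamily.of_contDiff (contDiff_comp_y hs)).add
    ((IsPolyFamily.param k).mul (.of_contDiff (contDiff_comp_y hr)))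

lemma isPolyFamily_deriv {k : ℕ} {s r : ℝ → ℝ} (hs : ContDiff ℝ (k + 1) s)
    (hr : ContDiff ℝ (k + 1) r) :
    IsPolyFamily k fun t q => deriv (fun y => s y + t * r y) (q 1) := by
  have e : ∀ t y, deriv (fun y => s y + t * r y) y = deriv s y + t * deriv r y := fun t y =>
    (((hs.differentiable (by simp)) y).hasDerivAt.add
      (((hr.differentiable (by simp)) y).hasDerivAt.const_mul t)).deriv
  simp only [e]
  exact isPolyFamily_comp_y (contDiff_deriv (n := k) hs) (contDiff_deriv (n := k) hr)

section

variable {k : ℕ} {f h : Coeffs}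

lemma isPolyFamily_w (hf : f.IsContDiff k) (hh : h.IsContDiff k) :
    IsPolyFamily k fun t q => (f.perturb h t).w q :=
  ((IsPolyFamily.of_contDiff (contDiff_apply ℝ ℝ 0)).mul
    (isPolyFamily_comp_y hf.2.2.2.2.2.2.1 hh.2.2.2.2.2.2.1)).sub
    (isPolyFamily_comp_y hf.2.2.2.2.2.2.2.1 hh.2.2.2.2.2.2.2.1)

lemma isPolyFamily_a (hf : f.IsContDiff k) (hh : h.IsContDiff k) :
    IsPolyFamily k fun t q => (f.perturb h t).a q :=
  ((isPolyFamily_comp_y hf.2.2.2.2.2.2.1 hh.2.2.2.2.2.2.1).mul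
    (IsPolyFamily.of_contDiff (contDiff_apply ℝ ℝ 2))).add
    (isPolyFamily_comp_y hf.2.2.2.2.2.2.2.2 hh.2.2.2.2.2.2.2.2)

lemma isPolyFamily_b (hf : f.IsContDiff k) (hh : h.IsContDiff k) :
    IsPolyFamily k fun t q => (f.perturb h t).b q :=
  ((isPolyFamily_comp_y hf.2.2.2.2.2.2.2.1 hh.2.2.2.2.2.2.2.1).mul
    (IsPolyFamily.of_contDiff (contDiff_apply ℝ ℝ 2))).add
    ((IsPolyFamily.of_contDiff (contDiff_apply ℝ ℝ 0)).mul
    (isPolyFamily_comp_y hf.2.2.2.2.2.2.2.2 hh.2.2.2.2.2.2.2.2))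

lemma isPolyFamily_bigPi (hf : f.IsContDiff k) (hh : h.IsContDiff k) :
    IsPolyFamily k fun t q => (f.perturb h t).bigPi q := by
  have hw := isPolyFamily_w hf hh
  have ha := isPolyFamily_a hf hh
  have hb := isPolyFamily_b hf hh
  obtain ⟨f1, f2, f3, f4, f5, f6, -⟩ := hf
  obtain ⟨h1, h2, h3, h4, h5, h6, -⟩ := hh
  simp only [bigPi_eq]
  exact ((((((isPolyFamily_comp_y f1 h1).mul (hb.mul hb)).sub
    ((isPolyFamily_comp_y f2 h2).mul (ha.mul hb))).add
    ((isPolyFamily_comp_y f4 h4).mul (ha.mul ha))).add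
    ((isPolyFamily_comp_y f5 h5).mul (hw.mul ha))).add
    ((isPolyFamily_comp_y f6 h6).mul (hw.mul hw))).sub
    ((isPolyFamily_comp_y f3 h3).mul (hw.mul hb))

lemma isPolyFamily_discr (hf : f.IsContDiff k) (hh : h.IsContDiff k) :
    IsPolyFamily k (discr f h) :=
  (isPolyFamily_w hf hh).mul (isPolyFamily_bigPi hf hh)

lemma isPolyFamily_qb (hf : f.IsContDiff k) (hh : h.IsContDiff k) :
    IsPolyFamily k fun t q => (f.perturb h t).qb q := by
  have hw := isPolyFamily_w hf hh
  have ha := isPolyFamily_a hf hh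
  have hb := isPolyFamily_b hf hh
  obtain ⟨f1, f2, f3, f4, f5, f6, -⟩ := hf
  obtain ⟨h1, h2, h3, h4, h5, h6, -⟩ := hh
  exact ((((IsPolyFamily.const k 2).mul (isPolyFamily_comp_y f1 h1)).mul hb).sub
    ((isPolyFamily_comp_y f2 h2).mul ha)).sub ((isPolyFamily_comp_y f3 h3).mul hw)

lemma isPolyFamily_qa (hf : f.IsContDiff k) (hh : h.IsContDiff k) :
    IsPolyFamily k fun t q => (f.perturb h t).qa q := by
  have hw := isPolyFamily_w hf hh
  have ha := isPolyFamily_a hf hh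
  have hb := isPolyFamily_b hf hh
  obtain ⟨f1, f2, f3, f4, f5, f6, -⟩ := hf
  obtain ⟨h1, h2, h3, h4, h5, h6, -⟩ := hh
  exact ((((IsPolyFamily.const k 2).mul (isPolyFamily_comp_y f4 h4)).mul ha).sub
    ((isPolyFamily_comp_y f2 h2).mul hb)).add ((isPolyFamily_comp_y f5 h5).mul hw)

lemma isPolyFamily_qw (hf : f.IsContDiff k) (hh : h.IsContDiff k) :
    IsPolyFamily k fun t q => (f.perturb h t).qw q := by
  have hw := isPolyFamily_w hf hh
  have ha := isPolyFamily_a hf hh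
  have hb := isPolyFamily_b hf hh
  obtain ⟨f1, f2, f3, f4, f5, f6, -⟩ := hf
  obtain ⟨h1, h2, h3, h4, h5, h6, -⟩ := hh
  exact (((isPolyFamily_comp_y f5 h5).mul ha).add
    (((IsPolyFamily.const k 2).mul (isPolyFamily_comp_y f6 h6)).mul hw)).sub
    ((isPolyFamily_comp_y f3 h3).mul hb)

lemma isPolyFamily_dualq (hf : f.IsContDiff k) (hh : h.IsContDiff k) :
    IsPolyFamily k fun t q => (f.perturb h t).dualq q := by
  have hx : IsPolyFamily k fun _ q => q 0 := .of_contDiff (contDiff_apply ℝ ℝ 0)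
  have hz : IsPolyFamily k fun _ q => q 2 := .of_contDiff (contDiff_apply ℝ ℝ 2)
  have two := IsPolyFamily.const k 2
  have four := IsPolyFamily.const k 4
  obtain ⟨f1, f2, f3, f4, f5, f6, -⟩ := hf
  obtain ⟨h1, h2, h3, h4, h5, h6, -⟩ := hh
  have pα := isPolyFamily_comp_y f1 h1
  have pβ := isPolyFamily_comp_y f2 h2
  have pγ := isPolyFamily_comp_y f3 h3
  have pδ := isPolyFamily_comp_y f4 h4
  have pε := isPolyFamily_comp_y f5 h5
  have pζ := isPolyFamily_comp_y f6 h6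
  exact ((((((pε.mul pε).sub ((four.mul pδ).mul pζ)).add
    ((((four.mul pβ).mul pζ).sub ((two.mul pγ).mul pε)).mul hx)).add
    ((((two.mul pβ).mul pε).sub ((four.mul pγ).mul pδ)).mul hz)).add
    (((pγ.mul pγ).sub ((four.mul pα).mul pζ)).mul (hx.mul hx))).add
    ((((two.mul pβ).mul pγ).sub ((four.mul pα).mul pε)).mul (hx.mul hz))).add
    (((pβ.mul pβ).sub ((four.mul pα).mul pδ)).mul (hz.mul hz))

lemma isPolyFamily_polyMetric (hf : f.IsContDiff k) (hh : h.IsContDiff k) (i j : Fin 3) :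
    IsPolyFamily k fun t q => (f.perturb h t).polyMetric q i j := by
  have hx : IsPolyFamily k fun _ q => q 0 := .of_contDiff (contDiff_apply ℝ ℝ 0)
  have hz : IsPolyFamily k fun _ q => q 2 := .of_contDiff (contDiff_apply ℝ ℝ 2)
  have hw := isPolyFamily_w hf hh
  have ha := isPolyFamily_a hf hh
  have hqa := isPolyFamily_qa hf hh
  have hqb := isPolyFamily_qb hf hh
  have h01 := (isPolyFamily_qw hf hh).sub (hz.mul hqb)
  have h02 := (ha.mul hw).neg
  have h12 := (hx.mul hqb).add hqa
  fin_cases i <;> fin_cases j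
  exacts [ha.mul ha, h01, h02, h01, isPolyFamily_dualq hf hh, h12, h02, h12, hw.mul hw]

lemma isRatFamily_metric (hf : f.IsContDiff k) (hh : h.IsContDiff k) (i j : Fin 3) :
    IsRatFamily (discr f h) k fun t q => (f.perturb h t).metric q i j :=
  (isPolyFamily_polyMetric hf hh i j).isRatFamily.congr fun t q hS => by
    rw [metric_eq_polyMetric _ (discr_ne_zero.1 hS).1]

lemma isRatFamily_inv_bigPi (hf : f.IsContDiff k) (hh : h.IsContDiff k) :
    IsRatFamily (discr f h) k fun t q => 1 / (f.perturb h t).bigPi q :=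
  (IsRatFamily.const 1).div_of_mul_eq (isPolyFamily_w hf hh) 1 fun t q _ => by
    rw [discr]; ring

lemma isRatFamily_metric_inv (hf : f.IsContDiff k) (hh : h.IsContDiff k) (i j : Fin 3) :
    IsRatFamily (discr f h) k fun t q => ((f.perturb h t).metric q)⁻¹ i j := by
  have hS := isPolyFamily_discr hf hh
  have hi := isRatFamily_inv_bigPi hf hh
  have hm := isRatFamily_metric hf hh
  have had : IsRatFamily (discr f h) k fun t q => ((f.perturb h t).metric q).adjugate i j := by
    simp only [Matrix.adjugate_fin_three]
    have h2 : ∀ a b c d a' b' c' d', IsRatFamily (discr f h) k fun t q =>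
        (f.perturb h t).metric q a b * (f.perturb h t).metric q c d
          - (f.perturb h t).metric q a' b' * (f.perturb h t).metric q c' d' :=
      fun a b c d a' b' c' d' => ((hm a b).mul (hm c d)).sub hS ((hm a' b').mul (hm c' d'))
    have h3 : ∀ a b c d a' b' c' d', IsRatFamily (discr f h) k fun t q =>
        -((f.perturb h t).metric q a b * (f.perturb h t).metric q c d)
          + (f.perturb h t).metric q a' b' * (f.perturb h t).metric q c' d' :=
      fun a b c d a' b' c' d' => ((hm a b).mul (hm c d)).neg.add hS ((hm a' b').mul (hm c' d'))
    fin_cases i <;> fin_cases j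
    exacts [h2 _ _ _ _ _ _ _ _, h3 _ _ _ _ _ _ _ _, h2 _ _ _ _ _ _ _ _, h3 _ _ _ _ _ _ _ _,
      h2 _ _ _ _ _ _ _ _, h3 _ _ _ _ _ _ _ _, h2 _ _ _ _ _ _ _ _, h3 _ _ _ _ _ _ _ _,
      h2 _ _ _ _ _ _ _ _]
  refine ((((IsRatFamily.const (-(1 / 4))).mul hi).mul hi).mul had).congr fun t q hq => ?_
  have hq' := discr_ne_zero.1 hq
  have hP : (f.perturb h t).bigPi q ≠ 0 := hq'.2
  rw [Matrix.inv_def, Matrix.smul_apply, Ring.inverse_eq_inv', det_metric _ hq'.1, smul_eq_mul]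
  have e : (-(2 * (f.perturb h t).bigPi q) ^ 2)⁻¹
      = -(1 / 4) * (1 / (f.perturb h t).bigPi q) * (1 / (f.perturb h t).bigPi q) :=
    (eq_inv_of_mul_eq_one_left (by field_simp; ring)).symm
  rw [e]

lemma isRatFamily_form (hf : f.IsContDiff (k + 1)) (hh : h.IsContDiff (k + 1)) (i : Fin 3) :
    IsRatFamily (discr f h) k fun t q => (f.perturb h t).form q i := by
  obtain ⟨-, -, -, -, -, -, d7, d8, d9⟩ := id hf
  obtain ⟨-, -, -, -, -, -, e7, e8, e9⟩ := id hh
  replace hf : f.IsContDiff k := hf.of_le le_self_add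
  replace hh : h.IsContDiff k := hh.of_le le_self_add
  have hS := isPolyFamily_discr hf hh
  have hi := isRatFamily_inv_bigPi hf hh
  have hx : IsPolyFamily k fun _ q => q 0 := .of_contDiff (contDiff_apply ℝ ℝ 0)
  have hw := isPolyFamily_w hf hh
  have ha := isPolyFamily_a hf hh
  have hb := isPolyFamily_b hf hh
  have hqa := isPolyFamily_qa hf hh
  have hqb := isPolyFamily_qb hf hh
  have dl := isPolyFamily_deriv d7 e7
  have dμ := isPolyFamily_deriv d8 e8
  have dν := isPolyFamily_deriv d9 e9
  have h3 : IsPolyFamily k fun t q => (f.perturb h t).coeff3 q := by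
    simp only [coeff3_eq]
    exact ((hqb.neg.add (hw.mul dν)).add (dμ.mul ha)).sub (dl.mul hb)
  have h2 : IsPolyFamily k fun t q => (f.perturb h t).coeff2 q :=
    (((((IsPolyFamily.const k 2).mul hx).mul (isPolyFamily_comp_y hf.1 hh.1)).sub
      (isPolyFamily_comp_y hf.2.1 hh.2.1)).add (hx.mul dl)).sub dμ
  have hK : IsRatFamily (discr f h) k fun t q =>
      (f.perturb h t).coeff3 q / (2 * (f.perturb h t).bigPi q) :=
    ((h3.isRatFamily.mul (.const (1 / 2))).mul hi).congr fun t q _ => by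
      rw [div_mul_eq_div_div]; ring
  have hA : ∀ i, IsRatFamily (discr f h) k fun t q =>
      (![-((f.perturb h t).a q * ((f.perturb h t).coeff3 q / (2 * (f.perturb h t).bigPi q))),
      ((q 0 * (f.perturb h t).qb q + (f.perturb h t).qa q)
          * ((f.perturb h t).coeff3 q / (2 * (f.perturb h t).bigPi q))
        + (f.perturb h t).coeff2 q) / (f.perturb h t).w q,
      (f.perturb h t).w q
        * ((f.perturb h t).coeff3 q / (2 * (f.perturb h t).bigPi q))] : Fin 3 → ℝ) i := by
    intro i
    fin_cases i
    · exact (ha.isRatFamily.mul hK).neg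
    · exact ((((hx.mul hqb).add hqa).isRatFamily.mul hK).add hS h2.isRatFamily).div_of_mul_eq
        (isPolyFamily_bigPi hf hh) 1 fun t q _ => by rw [discr]; ring
    · exact hw.isRatFamily.mul hK
  exact (hA i).congr fun t q hq => by rw [form_eq _ (discr_ne_zero.1 hq)]

end

lemma isRatFamily_extD {f h : Coeffs} (hf : f.IsContDiff 2) (hh : h.IsContDiff 2) (i j : Fin 3) :
    IsRatFamily (discr f h) 0 fun t q => extD (f.perturb h t).form q i j := by
  have hS := isPolyFamily_discr (k := 1) (hf.of_le (by norm_num)) (hh.of_le (by norm_num))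
  have hA : ∀ i, IsRatFamily (discr f h) 1 fun t q => (f.perturb h t).form q i :=
    isRatFamily_form (k := 1) (hf.of_le (by norm_num)) (hh.of_le (by norm_num))
  exact ((hA j).pd hS i).sub (hS.of_le zero_le_one) ((hA i).pd hS j)

/-- If a rational function of the perturbation parameter, invariant under homotheties, does not
vanish for the nine functions `h`, then it does not vanish for `f + t h` and small `t ≠ 0`:
up to a homothety, `f + t h` for large `t` is close to `h`. -/
lemma eventually_perturb {F : Coeffs → Pt → ℝ}
    (hF : ∀ f h, IsContDiff 3 f → IsContDiff 3 h →
      IsRatFamily (discr f h) 0 fun t q => F (f.perturb h t) q)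
    (hom : ∀ f r, IsContDiff 3 f → r ≠ 0 → F (f.affine 0 0 0 r) = F f)
    {f h : Coeffs} (hf : f.IsContDiff 3) (hh : h.IsContDiff 3) {p : Pt} (hp : p ∈ h.domain)
    (h0 : F h p ≠ 0) :
    ∀ᶠ t in 𝓝[≠] (0 : ℝ), p ∈ (f.perturb h t).domain ∧ F (f.perturb h t) p ≠ 0 := by
  have hS : ∀ f h, IsContDiff 3 f → IsContDiff 3 h → IsPolyFamily 0 (discr f h) :=
    fun f h hf hh => isPolyFamily_discr (hf.of_le (by simp)) (hh.of_le (by simp))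
  have h1 := (hF h f hh hf).eventually_ne (hS h f hh hf) (p := p) (t₀ := 0)
    (by rwa [discr_ne_zero, perturb_zero]) (by rwa [perturb_zero])
  obtain ⟨s, ⟨hs1, hs2⟩, hs0⟩ := (h1.and self_mem_nhdsWithin).exists
  have hs0 : s ≠ 0 := hs0
  have e := perturb_inv f h hs0
  have h2 := (hF f h hf hh).eventually_ne (hS f h hf hh) (p := p) (t₀ := s⁻¹)
    (by
      rw [discr_ne_zero, e, mem_domain_affine (inv_ne_zero hs0)]
      have : shear 0 0 0 p = p := by funext i; fin_cases i <;> simp [shear]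
      rw [this]
      exact discr_ne_zero.1 hs1)
    (by rwa [e, hom _ _ (hh.perturb hf s) (inv_ne_zero hs0)])
  exact h2.mono fun t ht => ⟨discr_ne_zero.1 ht.1, ht.2⟩

/-- A direction `h` for which the claim holds at `t = ∞`, in the sense of homotheties, is good for
small `t ≠ 0`. -/
lemma eventually_generic {f h : Coeffs} (hf : f.IsContDiff 3) (hh : h.IsContDiff 3) {p : Pt}
    (hp : p ∈ h.domain) (hA : ∃ i j, extD h.form p i j ≠ 0)
    (hC : ∀ i j k, j ≠ k → cotton h.metric p i j k ≠ 0) :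
    ∀ᶠ t in 𝓝[≠] (0 : ℝ), p ∈ (f.perturb h t).domain ∧
      (∃ i j, extD (f.perturb h t).form p i j ≠ 0) ∧
      ∀ i j k, j ≠ k → cotton (f.perturb h t).metric p i j k ≠ 0 := by
  obtain ⟨i, j, hij⟩ := hA
  have h1 := eventually_perturb (F := fun f q => extD f.form q i j)
    (fun f h hf hh => isRatFamily_extD (hf.of_le (by norm_num)) (hh.of_le (by norm_num)) i j)
    (fun f r hf hr => by rw [form_homothety (hf.of_le (by norm_num)) hr]) hf hh hp hij
  have h2 : ∀ i j k, j ≠ k → ∀ᶠ t in 𝓝[≠] (0 : ℝ), p ∈ (f.perturb h t).domain ∧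
      cotton (f.perturb h t).metric p i j k ≠ 0 := fun i j k hjk =>
    eventually_perturb (F := fun f q => cotton f.metric q i j k)
      (fun f h hf hh => isRatFamily_cotton
        (isPolyFamily_discr (k := 3) (by exact_mod_cast hf) (by exact_mod_cast hh))
        (isRatFamily_metric (by exact_mod_cast hf) (by exact_mod_cast hh))
        (isRatFamily_metric_inv (by exact_mod_cast hf) (by exact_mod_cast hh)) i j k)
      (fun f r _ hr => by rw [metric_homothety f hr, cotton_smul (pow_ne_zero 2 hr)])
      hf hh hp (hC i j k hjk)
  have h3 : ∀ᶠ t in 𝓝[≠] (0 : ℝ), ∀ i j k, j ≠ k →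
      cotton (f.perturb h t).metric p i j k ≠ 0 := by
    simp only [Filter.eventually_all]
    exact fun i j k hjk => (h2 i j k hjk).mono fun t ht => ht.2
  filter_upwards [h1, h3] with t ht ht'
  exact ⟨ht.1, ⟨i, j, ht.2⟩, ht'⟩

end Coeffs

/-! ### An explicit member of the family -/

/-!
The example attached to a point `(x₀, y₀, z₀)` has `α = β = δ = 0`, `γ = λ = 1` and constants
`ε, ζ, μ, ν` chosen such that `w = u` and `Π = u s` in the coordinates `u = x - x₀ + 1` and
`s = u + 2 (z - z₀)`. Its metric does not depend on `y`. The tables below give the components in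
the basis `dx, dy, dz` as functions of `u` and `s`; in these coordinates `∂/∂x = ∂/∂u + ∂/∂s` and
`∂/∂z = 2 ∂/∂s`, and the point itself is `u = s = 1`.
-/

namespace Example

/-- The components of the metric of the example. -/
noncomputable def gTab (u s : ℝ) : Fin 3 → Fin 3 → ℝ :=
  ![![-s * u / 2 + (s * s) / 4 + u * u / 4, s + s * u / 2 + u - u * u / 2, -s * u / 2 + u * u / 2],
    ![s + s * u / 2 + u - u * u / 2, 4 - 4 * u + (u * u), 2 * u - (u * u)],
    ![-s * u / 2 + u * u / 2, 2 * u - (u * u), (u * u)]]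

/-- The derivatives `∂/∂u` of `gTab`. -/
noncomputable def gTabu (u s : ℝ) : Fin 3 → Fin 3 → ℝ :=
  ![![-s / 2 + u / 2, 1 + s / 2 - u, -s / 2 + u],
    ![1 + s / 2 - u, -4 + 2 * u, 2 - 2 * u],
    ![-s / 2 + u, 2 - 2 * u, 2 * u]]

/-- The derivatives `∂/∂s` of `gTab`. -/
noncomputable def gTabs (u s : ℝ) : Fin 3 → Fin 3 → ℝ :=
  ![![s / 2 - u / 2, 1 + u / 2, -u / 2],
    ![1 + u / 2, 0, 0],
    ![-u / 2, 0, 0]]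

/-- The components of the Schouten tensor. -/
noncomputable def PTab (u s : ℝ) : Fin 3 → Fin 3 → ℝ :=
  ![![-5 / 128 + u / (4 * (s * s)) - 5 * u * u / (128 * (s * s)) + 1 / (4 * s) + 5 * u / (64 * s)
    - 1 / (2 * u), 1 / (2 * (s * s)) - 13 * u / (32 * (s * s)) + 5 * u * u / (64 * (s * s))
    - 5 / (32 * s) - 5 * u / (64 * s),
    u / (2 * (s * s)) - 5 * u * u / (64 * (s * s)) + 1 / (4 * s) + 5 * u / (64 * s)],
    ![1 / (2 * (s * s)) - 13 * u / (32 * (s * s)) + 5 * u * u / (64 * (s * s)) - 5 / (32 * s)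
      - 5 * u / (64 * s), -5 / (8 * (s * s)) + 5 * u / (8 * (s * s)) - 5 * u * u / (32 * (s * s)),
      1 / (s * s) - 13 * u / (16 * (s * s)) + 5 * u * u / (32 * (s * s))],
    ![u / (2 * (s * s)) - 5 * u * u / (64 * (s * s)) + 1 / (4 * s) + 5 * u / (64 * s),
      1 / (s * s) - 13 * u / (16 * (s * s)) + 5 * u * u / (32 * (s * s)),
      u / (s * s) - 5 * u * u / (32 * (s * s))]]

/-- The derivatives `∂/∂u` of `PTab`. -/
noncomputable def PTabu (u s : ℝ) : Fin 3 → Fin 3 → ℝ :=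
  ![![1 / (4 * (s * s)) - 5 * u / (64 * (s * s)) + 5 / (64 * s) + 1 / (2 * (u * u)),
    -13 / (32 * (s * s)) + 5 * u / (32 * (s * s)) - 5 / (64 * s),
    1 / (2 * (s * s)) - 5 * u / (32 * (s * s)) + 5 / (64 * s)],
    ![-13 / (32 * (s * s)) + 5 * u / (32 * (s * s)) - 5 / (64 * s),
      5 / (8 * (s * s)) - 5 * u / (16 * (s * s)), -13 / (16 * (s * s)) + 5 * u / (16 * (s * s))],
    ![1 / (2 * (s * s)) - 5 * u / (32 * (s * s)) + 5 / (64 * s),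
      -13 / (16 * (s * s)) + 5 * u / (16 * (s * s)), 1 / (s * s) - 5 * u / (16 * (s * s))]]

/-- The derivatives `∂/∂s` of `PTab`. -/
noncomputable def PTabs (u s : ℝ) : Fin 3 → Fin 3 → ℝ :=
  ![![-u / (2 * (s * s * s)) + 5 * u * u / (64 * (s * s * s)) - 1 / (4 * (s * s))
    - 5 * u / (64 * (s * s)), -1 / (s * s * s) + 13 * u / (16 * (s * s * s))
    - 5 * u * u / (32 * (s * s * s)) + 5 / (32 * (s * s)) + 5 * u / (64 * (s * s)),
    -u / (s * s * s) + 5 * u * u / (32 * (s * s * s)) - 1 / (4 * (s * s)) - 5 * u / (64 * (s * s))],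
    ![-1 / (s * s * s) + 13 * u / (16 * (s * s * s)) - 5 * u * u / (32 * (s * s * s))
      + 5 / (32 * (s * s)) + 5 * u / (64 * (s * s)),
      5 / (4 * (s * s * s)) - 5 * u / (4 * (s * s * s)) + 5 * u * u / (16 * (s * s * s)),
      -2 / (s * s * s) + 13 * u / (8 * (s * s * s)) - 5 * u * u / (16 * (s * s * s))],
    ![-u / (s * s * s) + 5 * u * u / (32 * (s * s * s)) - 1 / (4 * (s * s))
      - 5 * u / (64 * (s * s)), -2 / (s * s * s) + 13 * u / (8 * (s * s * s))
      - 5 * u * u / (16 * (s * s * s)), -2 * u / (s * s * s) + 5 * u * u / (16 * (s * s * s))]]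

/-- The Christoffel symbols `Γⁱ_{jk}`. -/
noncomputable def ΓTab (u s : ℝ) : Fin 3 → Fin 3 → Fin 3 → ℝ :=
  ![![![-1 / 4 + u / (4 * s) + 1 / u, 1 / (2 * s) - u / (4 * s), u / (4 * s)],
    ![1 / (2 * s) - u / (4 * s), 0, 0], ![u / (4 * s), 0, 0]],
    ![![1 / 2 - u / (4 * s) - s / (4 * u), -3 / 8 + 3 * u / (8 * s), 1 / 2 - u / (2 * s)],
      ![-3 / 8 + 3 * u / (8 * s), 1 / s - u / (2 * s), 3 * u / (4 * s)],
      ![1 / 2 - u / (2 * s), 3 * u / (4 * s), -u / s]],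
    ![![3 / 4 + 1 / (2 * s) - 3 * u / (8 * s) - 3 * s / (8 * u) - 1 / (2 * u),
      -1 / 2 - 1 / s + u / (2 * s) - 1 / (2 * u), 5 / 8 + 1 / s - 5 * u / (8 * s)],
      ![-1 / 2 - 1 / s + u / (2 * s) - 1 / (2 * u), 2 / s - 2 / (s * u) - u / (2 * s),
      -3 / (2 * s) + 3 * u / (4 * s)], ![5 / 8 + 1 / s - 5 * u / (8 * s),
      -3 / (2 * s) + 3 * u / (4 * s), 2 / s - u / s]]]

/-- The derivatives `∂/∂u` of `ΓTab`. -/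
noncomputable def ΓTabu (u s : ℝ) : Fin 3 → Fin 3 → Fin 3 → ℝ :=
  ![![![1 / (4 * s) - 1 / (u * u), -1 / (4 * s), 1 / (4 * s)], ![-1 / (4 * s), 0, 0],
    ![1 / (4 * s), 0, 0]],
    ![![-1 / (4 * s) + s / (4 * (u * u)), 3 / (8 * s), -1 / (2 * s)], ![3 / (8 * s), -1 / (2 * s),
      3 / (4 * s)], ![-1 / (2 * s), 3 / (4 * s), -1 / s]],
    ![![-3 / (8 * s) + 3 * s / (8 * (u * u)) + 1 / (2 * (u * u)), 1 / (2 * s) + 1 / (2 * (u * u)),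
      -5 / (8 * s)], ![1 / (2 * s) + 1 / (2 * (u * u)), -1 / (2 * s) + 2 / (s * (u * u)),
      3 / (4 * s)], ![-5 / (8 * s), 3 / (4 * s), -1 / s]]]

/-- The derivatives `∂/∂s` of `ΓTab`. -/
noncomputable def ΓTabs (u s : ℝ) : Fin 3 → Fin 3 → Fin 3 → ℝ :=
  ![![![-u / (4 * (s * s)), -1 / (2 * (s * s)) + u / (4 * (s * s)), -u / (4 * (s * s))],
    ![-1 / (2 * (s * s)) + u / (4 * (s * s)), 0, 0], ![-u / (4 * (s * s)), 0, 0]],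
    ![![u / (4 * (s * s)) - 1 / (4 * u), -3 * u / (8 * (s * s)), u / (2 * (s * s))],
      ![-3 * u / (8 * (s * s)), -1 / (s * s) + u / (2 * (s * s)), -3 * u / (4 * (s * s))],
      ![u / (2 * (s * s)), -3 * u / (4 * (s * s)), u / (s * s)]],
    ![![-1 / (2 * (s * s)) + 3 * u / (8 * (s * s)) - 3 / (8 * u), 1 / (s * s) - u / (2 * (s * s)),
      -1 / (s * s) + 5 * u / (8 * (s * s))], ![1 / (s * s) - u / (2 * (s * s)),
      -2 / (s * s) + 2 / ((s * s) * u) + u / (2 * (s * s)),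
      3 / (2 * (s * s)) - 3 * u / (4 * (s * s))], ![-1 / (s * s) + 5 * u / (8 * (s * s)),
      3 / (2 * (s * s)) - 3 * u / (4 * (s * s)), -2 / (s * s) + u / (s * s)]]]

/-- The components of the inverse metric. -/
noncomputable def giTab (u s : ℝ) : Fin 3 → Fin 3 → ℝ :=
  ![![0, 1 / (2 * s), 1 / (2 * s) - 1 / (s * u)],
    ![1 / (2 * s), 0, -1 / (4 * s) + 1 / (4 * u)],
    ![1 / (2 * s) - 1 / (s * u), -1 / (4 * s) + 1 / (4 * u),
      -1 / (2 * s) + 1 / (s * u) + 1 / (2 * u)]]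

/-- The components of the Ricci tensor; the scalar curvature is `1 / (8 s²)`. -/
noncomputable def ricTab (u s : ℝ) (i j : Fin 3) : ℝ :=
  PTab u s i j + gTab u s i j / (32 * (s * s))

set_option linter.unnecessarySeqFocus false in
/-- `u` and `s` enter through their jets: `u_x = s_x = 1`, `s_z = 2`, and the other first
derivatives vanish. -/
lemma hasJet1_gTab {u s : Pt → ℝ} {q : Pt} (hu : HasJet1 u q ⟨u q, ![1, 0, 0]⟩)
    (hs : HasJet1 s q ⟨s q, ![1, 0, 2]⟩) (i j : Fin 3) :
    HasJet1 (fun q => gTab (u q) (s q) i j) q ⟨gTab (u q) (s q) i j,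
      ![gTabu (u q) (s q) i j + gTabs (u q) (s q) i j, 0, 2 * gTabs (u q) (s q) i j]⟩ := by
  fin_cases i <;> fin_cases j <;>
    (simp only [gTab, gTabu, gTabs, Fin.zero_eta, Fin.mk_one, Fin.reduceFinMk,
       Matrix.cons_val]
     apply HasJet1.of_eq
     · repeat' first
         | exact hu
         | exact hs
         | exact HasJet1.const _ _
         | apply HasJet1.div
         | apply HasJet1.add
         | apply HasJet1.sub
         | apply HasJet1.mul
         | apply HasJet1.neg
       all_goals simp 
     · simp <;> ring
     · intro i; fin_cases i <;> simp <;> ring)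

set_option linter.unnecessarySeqFocus false in
lemma hasJet1_ΓTab {u s : Pt → ℝ} {q : Pt} (hu : HasJet1 u q ⟨u q, ![1, 0, 0]⟩)
    (hs : HasJet1 s q ⟨s q, ![1, 0, 2]⟩) (hu0 : u q ≠ 0) (hs0 : s q ≠ 0) (i j k : Fin 3) :
    HasJet1 (fun q => ΓTab (u q) (s q) i j k) q ⟨ΓTab (u q) (s q) i j k,
      ![ΓTabu (u q) (s q) i j k + ΓTabs (u q) (s q) i j k, 0, 2 * ΓTabs (u q) (s q) i j k]⟩ := by
  fin_cases i <;> fin_cases j <;> fin_cases k <;>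
    (simp only [ΓTab, ΓTabu, ΓTabs, Fin.zero_eta, Fin.mk_one, Fin.reduceFinMk,
       Matrix.cons_val]
     apply HasJet1.of_eq
     · repeat' first
         | exact hu
         | exact hs
         | exact HasJet1.const _ _
         | apply HasJet1.div
         | apply HasJet1.add
         | apply HasJet1.sub
         | apply HasJet1.mul
         | apply HasJet1.neg
       all_goals simp [hu0, hs0]
     · simp <;> ring
     · intro i; fin_cases i <;> simp <;> field_simp <;> ring)

set_option linter.unnecessarySeqFocus false in
lemma hasJet1_PTab {u s : Pt → ℝ} {q : Pt} (hu : HasJet1 u q ⟨u q, ![1, 0, 0]⟩)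
    (hs : HasJet1 s q ⟨s q, ![1, 0, 2]⟩) (hu0 : u q ≠ 0) (hs0 : s q ≠ 0) (i j : Fin 3) :
    HasJet1 (fun q => PTab (u q) (s q) i j) q ⟨PTab (u q) (s q) i j,
      ![PTabu (u q) (s q) i j + PTabs (u q) (s q) i j, 0, 2 * PTabs (u q) (s q) i j]⟩ := by
  fin_cases i <;> fin_cases j <;>
    (simp only [PTab, PTabu, PTabs, Fin.zero_eta, Fin.mk_one, Fin.reduceFinMk,
       Matrix.cons_val]
     apply HasJet1.of_eq
     · repeat' first
         | exact hu
         | exact hs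
         | exact HasJet1.const _ _
         | apply HasJet1.div
         | apply HasJet1.add
         | apply HasJet1.sub
         | apply HasJet1.mul
         | apply HasJet1.neg
       all_goals simp [hu0, hs0]
     · simp <;> ring
     · intro i; fin_cases i <;> simp <;> field_simp <;> ring)

lemma giTab_mul_gTab {u s : ℝ} (hu : u ≠ 0) (hs : s ≠ 0) :
    Matrix.of (giTab u s) * Matrix.of (gTab u s) = 1 := by
  ext i j
  fin_cases i <;> fin_cases j <;>
    simp [Matrix.mul_apply, Fin.sum_univ_three, giTab, gTab] <;> field_simp <;> ring

lemma ΓTab_symm (u s : ℝ) (i j k : Fin 3) : ΓTab u s i j k = ΓTab u s i k j := by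
  fin_cases i <;> fin_cases j <;> fin_cases k <;> rfl

/-- The connection given by `ΓTab` preserves the metric given by `gTab`. -/
lemma ΓTab_compatible {u s : ℝ} (hu : u ≠ 0) (hs : s ≠ 0) (k i j : Fin 3) :
    ![gTabu u s i j + gTabs u s i j, 0, 2 * gTabs u s i j] k
      - ∑ l, ΓTab u s l k i * gTab u s l j - ∑ l, ΓTab u s l k j * gTab u s i l = 0 := by
  simp only [Fin.sum_univ_three]
  fin_cases k <;> fin_cases i <;> fin_cases j <;>
    (simp [ΓTab, gTab, gTabu, gTabs]
     try field_simp
     try ring)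

/-- The Ricci tensor of the connection given by `ΓTab`. -/
lemma ricTab_eq {u s : ℝ} (hu : u ≠ 0) (hs : s ≠ 0) (i j : Fin 3) :
    (∑ k, (![ΓTabu u s k j i + ΓTabs u s k j i, 0, 2 * ΓTabs u s k j i] k
      - ![ΓTabu u s k k i + ΓTabs u s k k i, 0, 2 * ΓTabs u s k k i] j
      + ∑ m, (ΓTab u s k k m * ΓTab u s m j i - ΓTab u s k j m * ΓTab u s m k i)))
      = ricTab u s i j := by
  simp only [Fin.sum_univ_three]
  fin_cases i <;> fin_cases j <;>
    (simp [ΓTab, ΓTabu, ΓTabs, ricTab, PTab, gTab]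
     try field_simp
     try ring)

lemma scalar_ricTab {u s : ℝ} (hu : u ≠ 0) (hs : s ≠ 0) :
    ∑ i, ∑ j, giTab u s i j * ricTab u s i j = 1 / (8 * (s * s)) := by
  simp only [Fin.sum_univ_three]
  simp [giTab, ricTab, PTab, gTab]
  field_simp
  ring

/-- The nine constants of the example attached to the point `p`. -/
noncomputable def coeffs (p : Pt) : Coeffs where
  α := fun _ => 0
  β := fun _ => 0
  γ := fun _ => 1
  δ := fun _ => 0
  ε := fun _ => 1 + p 0
  ζ := fun _ => 1 - p 2
  lam := fun _ => 1
  μ := fun _ => p 0 - 1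
  ν := fun _ => -p 2

/-- The coordinate `u`, equal to `w`, with value `1` at `p`. -/
def U (p q : Pt) : ℝ := q 0 - p 0 + 1

/-- The coordinate `s`, equal to `Π / w`, with value `1` at `p`. -/
def S (p q : Pt) : ℝ := U p q + 2 * (q 2 - p 2)

@[simp] lemma U_self (p : Pt) : U p p = 1 := by simp [U]
@[simp] lemma S_self (p : Pt) : S p p = 1 := by simp [S]

lemma isContDiff_coeffs (p : Pt) (n : WithTop ℕ∞) : (coeffs p).IsContDiff n :=
  ⟨contDiff_const, contDiff_const, contDiff_const, contDiff_const, contDiff_const, contDiff_const,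
    contDiff_const, contDiff_const, contDiff_const⟩

lemma w_coeffs (p q : Pt) : (coeffs p).w q = U p q := by
  simp [Coeffs.w, coeffs, U]; ring

lemma bigPi_coeffs (p q : Pt) : (coeffs p).bigPi q = U p q * S p q := by
  rw [Coeffs.bigPi_eq]
  simp [Coeffs.w, Coeffs.a, Coeffs.b, coeffs, U, S]; ring

lemma mem_domain_coeffs (p : Pt) : p ∈ (coeffs p).domain := by
  simp [Coeffs.domain, w_coeffs, bigPi_coeffs]

lemma metric_coeffs {p q : Pt} (hU : U p q ≠ 0) :
    (coeffs p).metric q = Matrix.of (gTab (U p q) (S p q)) := by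
  rw [Coeffs.metric_eq_polyMetric _ (by rwa [w_coeffs])]
  ext i j
  fin_cases i <;> fin_cases j <;>
    simp [Coeffs.polyMetric, gTab, Coeffs.a, Coeffs.b, Coeffs.w, Coeffs.qa, Coeffs.qb, Coeffs.qw,
      Coeffs.dualq, coeffs, U, S] <;> ring

lemma hasJet1_U (p q : Pt) : HasJet1 (U p) q ⟨U p q, ![1, 0, 0]⟩ := by
  refine HasJet1.of_eq (((HasJet2.coord q 0).toJet1.sub (HasJet1.const (p 0) q)).add
    (HasJet1.const 1 q)) (by simp [U, Jet2.coord]) fun i => ?_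
  fin_cases i <;> simp [Jet2.coord]

lemma hasJet1_S (p q : Pt) : HasJet1 (S p) q ⟨S p q, ![1, 0, 2]⟩ := by
  refine HasJet1.of_eq ((hasJet1_U p q).add ((HasJet1.const 2 q).mul
    ((HasJet2.coord q 2).toJet1.sub (HasJet1.const (p 2) q)))) (by simp [S, Jet2.coord]) fun i => ?_
  fin_cases i <;> simp [Jet2.coord]

lemma eventually_ne {p q : Pt} (hU : U p q ≠ 0) (hS : S p q ≠ 0) :
    ∀ᶠ r in 𝓝 q, U p r ≠ 0 ∧ S p r ≠ 0 :=
  ((hasJet1_U p q).diff.continuousAt.eventually_ne hU).and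
    ((hasJet1_S p q).diff.continuousAt.eventually_ne hS)

lemma metric_coeffs_inv {p q : Pt} (hU : U p q ≠ 0) (hS : S p q ≠ 0) :
    ((coeffs p).metric q)⁻¹ = Matrix.of (giTab (U p q) (S p q)) := by
  rw [metric_coeffs hU]
  exact Matrix.inv_eq_left_inv (giTab_mul_gTab hU hS)

lemma leviCivita_coeffs {p q : Pt} (hU : U p q ≠ 0) (hS : S p q ≠ 0) :
    leviCivita (coeffs p).metric q = ΓTab (U p q) (S p q) := by
  refine (eq_weylConn (coeffs p).metric_symm ?_ ⟨ΓTab_symm _ _, fun k i j => ?_⟩).symm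
  · rw [metric_coeffs hU]
    intro h
    have := congrArg Matrix.det (giTab_mul_gTab hU hS)
    simp [h] at this
  · have h := ((hasJet1_gTab (hasJet1_U p q) (hasJet1_S p q) i j).congr
      (v := fun q => (coeffs p).metric q i j) ((eventually_ne hU hS).mono fun r hr => by
        simp only [metric_coeffs hr.1, Matrix.of_apply])).pd_eq k
    rw [h, metric_coeffs hU]
    simpa using ΓTab_compatible hU hS k i j

lemma ricci_coeffs {p q : Pt} (hU : U p q ≠ 0) (hS : S p q ≠ 0) (i j : Fin 3) :
    ricci (leviCivita (coeffs p).metric) q i j = ricTab (U p q) (S p q) i j := by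
  have h : ∀ i j k l, pd l (fun q => leviCivita (coeffs p).metric q i j k) q = _ := fun i j k =>
    ((hasJet1_ΓTab (hasJet1_U p q) (hasJet1_S p q) hU hS i j k).congr
      (v := fun q => leviCivita (coeffs p).metric q i j k)
      ((eventually_ne hU hS).mono fun r hr => by
        simp only [leviCivita_coeffs hr.1 hr.2])).pd_eq
  rw [← ricTab_eq hU hS]
  simp only [ricci, curv, h, leviCivita_coeffs hU hS]

lemma schouten_coeffs {p q : Pt} (hU : U p q ≠ 0) (hS : S p q ≠ 0) (i j : Fin 3) :
    schouten (coeffs p).metric q i j = PTab (U p q) (S p q) i j := by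
  have hsc : scalar (coeffs p).metric (leviCivita (coeffs p).metric) q
      = 1 / (8 * (S p q * S p q)) := by
    simp only [← scalar_ricTab hU hS, scalar, ricci_coeffs hU hS, metric_coeffs_inv hU hS,
      Matrix.of_apply]
  simp only [schouten, hsc, ricci_coeffs hU hS, metric_coeffs hU, Matrix.of_apply, ricTab]
  ring

/-- At `u = s = 1` the eighteen components are nonzero rational numbers. -/
lemma cotton_coeffs_ne_zero (p : Pt) {i j k : Fin 3} (hjk : j ≠ k) :
    cotton (coeffs p).metric p i j k ≠ 0 := by
  have hU : U p p ≠ 0 := by simp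
  have hS : S p p ≠ 0 := by simp
  have h : ∀ i j l, pd l (fun q => schouten (coeffs p).metric q i j) p = _ := fun i j =>
    ((hasJet1_PTab (hasJet1_U p p) (hasJet1_S p p) hU hS i j).congr
      (v := fun q => schouten (coeffs p).metric q i j) ((eventually_ne hU hS).mono fun r hr => by
        simp only [schouten_coeffs hr.1 hr.2])).pd_eq
  simp only [cotton, nablaSchouten, h, leviCivita_coeffs hU hS, schouten_coeffs hU hS, U_self,
    S_self, Fin.sum_univ_three]
  fin_cases j <;> fin_cases k <;> first | exact absurd rfl hjk | skip
  all_goals fin_cases i <;> simp [PTab, PTabu, PTabs, ΓTab] <;> norm_num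

/-- Here `A_x = u / (4 s) - 1 / 4` and `A_z = u / (2 s)`. -/
lemma extD_form_coeffs (p : Pt) : extD (coeffs p).form p 0 2 ≠ 0 := by
  have hf : ∀ᶠ q in 𝓝 p, (coeffs p).form q 2 = U p q / (2 * S p q) ∧
      (coeffs p).form q 0 = U p q / (4 * S p q) - 1 / 4 := by
    filter_upwards [eventually_ne (p := p) (q := p) (by simp) (by simp)] with q hq
    obtain ⟨hU, hS⟩ := hq
    have hc : (coeffs p).coeff3 q = U p q := by
      rw [Coeffs.coeff3_eq, ← w_coeffs]
      simp [coeffs, Coeffs.qb]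
    have ha : (coeffs p).a q = (S p q - U p q) / 2 := by simp [Coeffs.a, coeffs, S]; ring
    rw [Coeffs.form_eq _ (by simp [Coeffs.domain, w_coeffs, bigPi_coeffs, hU, hS])]
    simp only [Matrix.cons_val, hc, ha, w_coeffs, bigPi_coeffs]
    constructor
    · field_simp
    · field_simp
      ring
  have hU := hasJet1_U p p
  have hS := hasJet1_S p p
  have h2 := ((hU.div ((HasJet1.const 2 p).mul hS) (by simp)).congr
    (v := fun q => (coeffs p).form q 2) (hf.mono fun _ h => h.1)).pd_eq 0
  have h0 := (((hU.div ((HasJet1.const 4 p).mul hS) (by simp)).sub (HasJet1.const (1 / 4) p)).congr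
    (v := fun q => (coeffs p).form q 0) (hf.mono fun _ h => h.2)).pd_eq 2
  rw [extD, h2, h0]
  simp

end Example

end EinsteinWeyl

theorem theorem1p2 :
    (∀ (n : ℕ∞) (f : EinsteinWeyl.Coeffs), 1 ≤ n → f.IsContDiff (n + 1) →
      EinsteinWeyl.IsLorentzianEinsteinWeylOn n f.domain f.metric f.form) ∧
    (∀ f : EinsteinWeyl.Coeffs, f.IsContDiff 3 → ∀ p : EinsteinWeyl.Pt,
      ∃ h : EinsteinWeyl.Coeffs, h.IsContDiff ∞ ∧
        ∀ᶠ t in 𝓝[≠] (0 : ℝ),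
          p ∈ (f.perturb h t).domain ∧
          (∃ i j, EinsteinWeyl.extD (f.perturb h t).form p i j ≠ 0) ∧
          ∀ i j k, j ≠ k → EinsteinWeyl.cotton (f.perturb h t).metric p i j k ≠ 0) :=
  ⟨fun _ _ hn h => EinsteinWeyl.Coeffs.isLorentzianEinsteinWeylOn hn h, fun _ hf p =>
    ⟨EinsteinWeyl.Example.coeffs p, EinsteinWeyl.Example.isContDiff_coeffs p ∞,
      EinsteinWeyl.Coeffs.eventually_generic hf (EinsteinWeyl.Example.isContDiff_coeffs p 3)
        (EinsteinWeyl.Example.mem_domain_coeffs p)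
        ⟨0, 2, EinsteinWeyl.Example.extD_form_coeffs p⟩
        fun _ _ _ => EinsteinWeyl.Example.cotton_coeffs_ne_zero p⟩⟩
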